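/- Let $n\ge 2$, let $f\in C^1(\mathbb R)$, and let $u\in W^{3,1}_{\mathrm{loc}}(\mathbb R^n)$ be a radial (that is, $u(x)=g(|x|)$ for almost every $x$, for some function $g$) stable solution of $$\operatorname{div}\Bigl(\frac{\nabla u}{\sqrt{1+|\nabla u|^2}}\Bigr)=-f(u)\qquad\text{in }\mathbb R^n .$$ Here $\nabla u$ is the weak gradient, and "stable solution" means that $f(u)$ and $f'(u)$ belong to $L^1_{\mathrm{loc}}(\mathbb R^n)$, that $$\int_{\mathbb R^n}\frac{\nabla u\cdot\nabla\varphi}{\sqrt{1+|\nabla u|^2}}\,dx=\int_{\mathbb R^n}f(u)\,\varphi\,dx\qquad\text{for all }\varphi\in C_c^\infty(\mathbb R^n),$$ and that $$\int_{\mathbb R^n}f'(u)\,\xi^2\,dx\le\int_{\mathbb R^n}\Bigl(\frac{|\nabla\xi|^2}{\sqrt{1+|\nabla u|^2}}-\frac{(\nabla u\cdot\nabla\xi)^2}{(1+|\nabla u|^2)^{3/2}}\Bigr)dx\qquad\text{for all }\xi\in C_c^\infty(\mathbb R^n).$$ Let $B_r$ denote the ball of radius $r$ centred at the origin. Functions are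 identified when they agree almost everywhere; accordingly the growth conditions below are understood for almost every $x$. (1) If $u$ is nonconstant, then there are $c>0$ and $R_0>2$ such that $$\frac{1}{|B_{2R}\setminus B_R|}\int_{B_{2R}\setminus B_R}\frac{|\nabla u|^2}{(1+|\nabla u|^2)^{3/2}}\,dx\ \ge\ c\,R^{-n+2\sqrt{n-1}+2}\qquad\text{for all }R\ge R_0 .$$ (2) In particular, $u$ is constant if one of the following conditions holds: - $2\le n\le 6$; - $n\ge 7$ and $|\nabla u(x)|=o\bigl(|x|^{-n/2+\sqrt{n-1}+1}\bigr)$ as $|x|\to+\infty$; - $n\ge 7$ and $|\nabla u(x)|^{-1}=o\bigl(|x|^{-n+2\sqrt{n-1}+2}\bigr)$ as $|x|\to+\infty$ (in particular $\nabla u(x)\ne 0$ for $|x|$ large). -/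

import Mathlib

open MeasureTheory
open scoped ContDiff

noncomputable section

namespace StableMeanCurvature

/-- Test functions of class `C_c^∞(ℝⁿ)`. -/
def IsTestFunction {n : ℕ} (φ : EuclideanSpace ℝ (Fin n) → ℝ) : Prop :=
  ContDiff ℝ ∞ φ ∧ HasCompactSupport φ

/-- `v` is the `i`-th weak partial derivative of `u` on `ℝⁿ`
(both functions are required to be locally integrable where this is used). -/
def IsWeakPartial {n : ℕ} (i : Fin n) (u v : EuclideanSpace ℝ (Fin n) → ℝ) : Prop :=
  ∀ φ : EuclideanSpace ℝ (Fin n) → ℝ, IsTestFunction φ →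
    ∫ x, u x * fderiv ℝ φ x (EuclideanSpace.single i 1) = -∫ x, v x * φ x

/-- The local Sobolev space `W^{k,1}_loc(ℝⁿ)`: locally integrable functions whose weak partial
derivatives of order at most `k` exist and are locally integrable. -/
def MemSobolevLoc {n : ℕ} : ℕ → (EuclideanSpace ℝ (Fin n) → ℝ) → Prop
  | 0, u => LocallyIntegrable u volume
  | k + 1, u => LocallyIntegrable u volume ∧
      ∀ i : Fin n, ∃ v : EuclideanSpace ℝ (Fin n) → ℝ, IsWeakPartial i u v ∧ MemSobolevLoc k v

/-- The vector field `G` is a weak gradient `∇u` of the function `u ∈ W^{1,1}_loc(ℝⁿ)`.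
It is determined by `u` up to a null set. -/
structure IsWeakGradient {n : ℕ} (u : EuclideanSpace ℝ (Fin n) → ℝ)
    (G : EuclideanSpace ℝ (Fin n) → EuclideanSpace ℝ (Fin n)) : Prop where
  locallyIntegrable : LocallyIntegrable u volume
  locallyIntegrable_grad : LocallyIntegrable G volume
  weakPartial : ∀ i : Fin n, IsWeakPartial i u (fun x => G x i)

/-- `u`, with weak gradient `G`, is a weak solution on `ℝⁿ` of
`div (∇u / √(1 + |∇u|²)) = -f(u)`. -/
structure IsWeakSolution {n : ℕ} (f : ℝ → ℝ) (u : EuclideanSpace ℝ (Fin n) → ℝ)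
    (G : EuclideanSpace ℝ (Fin n) → EuclideanSpace ℝ (Fin n)) : Prop where
  weakGradient : IsWeakGradient u G
  locallyIntegrable_f : LocallyIntegrable (fun x => f (u x)) volume
  equation : ∀ φ : EuclideanSpace ℝ (Fin n) → ℝ, IsTestFunction φ →
    ∫ x, inner ℝ (G x) (gradient φ x) / √(1 + ‖G x‖ ^ 2) = ∫ x, f (u x) * φ x

/-- `u`, with weak gradient `G`, is a stable solution on `ℝⁿ` of
`div (∇u / √(1 + |∇u|²)) = -f(u)`. -/
structure IsStableSolution {n : ℕ} (f : ℝ → ℝ) (u : EuclideanSpace ℝ (Fin n) → ℝ)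
    (G : EuclideanSpace ℝ (Fin n) → EuclideanSpace ℝ (Fin n)) : Prop where
  weakSolution : IsWeakSolution f u G
  locallyIntegrable_deriv : LocallyIntegrable (fun x => deriv f (u x)) volume
  stable : ∀ ξ : EuclideanSpace ℝ (Fin n) → ℝ, IsTestFunction ξ →
    ∫ x, deriv f (u x) * ξ x ^ 2 ≤
      ∫ x, (‖gradient ξ x‖ ^ 2 / √(1 + ‖G x‖ ^ 2)
        - inner ℝ (G x) (gradient ξ x) ^ 2 / (1 + ‖G x‖ ^ 2) ^ (3 / 2 : ℝ))

/-- `u` is (almost everywhere equal to) a radial function about the origin. -/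
def IsRadial {n : ℕ} (u : EuclideanSpace ℝ (Fin n) → ℝ) : Prop :=
  ∃ g : ℝ → ℝ, ∀ᵐ x, u x = g ‖x‖

/-- `u` is (almost everywhere equal to) a constant. -/
def IsConstant {n : ℕ} (u : EuclideanSpace ℝ (Fin n) → ℝ) : Prop :=
  ∃ c : ℝ, ∀ᵐ x, u x = c

/-- `|G(x)| = o(|x|^q)` as `|x| → ∞`, for a field `G` defined almost everywhere. -/
def NormIsLittleO {n : ℕ} (G : EuclideanSpace ℝ (Fin n) → EuclideanSpace ℝ (Fin n))
    (q : ℝ) : Prop :=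
  ∀ ε : ℝ, 0 < ε → ∃ M : ℝ, ∀ᵐ x, M < ‖x‖ → ‖G x‖ ≤ ε * ‖x‖ ^ q

/-- `|G(x)|⁻¹ = o(|x|^q)` as `|x| → ∞`, for a field `G` defined almost everywhere; in particular
`G(x) ≠ 0` for almost every `x` with `|x|` large. -/
def InvNormIsLittleO {n : ℕ} (G : EuclideanSpace ℝ (Fin n) → EuclideanSpace ℝ (Fin n))
    (q : ℝ) : Prop :=
  ∀ ε : ℝ, 0 < ε → ∃ M : ℝ, ∀ᵐ x, M < ‖x‖ → G x ≠ 0 ∧ ‖G x‖⁻¹ ≤ ε * ‖x‖ ^ q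

end StableMeanCurvature

end

/-!
Write `u(x) = g(|x|)` and `p = g'`. Differentiating the radial equation shows that `p` nearly solves
the linearised equation, and testing stability with `p η` gives, with `J(t) = t² / (1 + t²)^{3/2}`,
the Hardy inequality `∫ r^{n-1} J(p) ((n - 1) η² / r² - η'²) dr ≤ 0`. Take for `η` a function with
`(r η')² < (n - 1) η²` which is of size `√r` near `0` and `r^{-√(n-1)}` near infinity, cut off on
`[R, 2R]`. Unless `p = 0`, the region `r ≤ R` contributes a positive amount bounded below, which
only the cut-off on `[R, 2R]` can compensate; hence `∫_R^{2R} r^{n-1} J(p) dr ≥ c R^{2√(n-1) + 2}`.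
Each of the conditions of the second part contradicts this, because `J(t) ≤ min(1, t², 1/t)`.
-/

noncomputable section

namespace StableMeanCurvature

open Set Filter Topology
open scoped Convolution

/-- Test functions of class `C_c^k(U)`, as functions on the whole space. -/
structure IsTestOn {E : Type*} [NormedAddCommGroup E] [NormedSpace ℝ E] (k : WithTop ℕ∞)
    (U : Set E) (φ : E → ℝ) : Prop where
  contDiff : ContDiff ℝ k φ
  hasCompactSupport : HasCompactSupport φ
  tsupport_subset : tsupport φ ⊆ U

theorem contDiff_of_contDiffOn_of_tsupport_subset {E F : Type*} [NormedAddCommGroup E]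
    [NormedSpace ℝ E] [NormedAddCommGroup F] [NormedSpace ℝ F] {k : WithTop ℕ∞} {U : Set E}
    {f : E → F} (hU : IsOpen U) (hf : ContDiffOn ℝ k f U) (hs : tsupport f ⊆ U) :
    ContDiff ℝ k f :=
  contMDiff_iff_contDiff.mp <| contMDiff_of_tsupport fun _ hx =>
    (hf.contDiffAt (hU.mem_nhds (hs hx))).contMDiffAt

theorem contDiffOn_one_of_hasDerivAt {F F' : ℝ → ℝ} {s : Set ℝ} (hs : IsOpen s)
    (hF : ∀ x ∈ s, HasDerivAt F (F' x) x) (hF' : ContinuousOn F' s) : ContDiffOn ℝ 1 F s :=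
  (contDiffOn_one_iff_derivWithin hs.uniqueDiffOn).mpr
    ⟨fun x hx => (hF x hx).differentiableAt.differentiableWithinAt,
      hF'.congr fun x hx => (hF x hx).hasDerivWithinAt.derivWithin (hs.uniqueDiffWithinAt hx)⟩

theorem integrable_mul_of_tsupport_subset {X : Type*} [TopologicalSpace X] [T2Space X]
    [MeasurableSpace X] [OpensMeasurableSpace X] {μ : Measure X} {U : Set X} {h φ : X → ℝ}
    (hh : LocallyIntegrableOn h U μ) (hφ : Continuous φ) (hc : HasCompactSupport φ)
    (hs : tsupport φ ⊆ U) : Integrable (fun x => h x * φ x) μ := by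
  have hK : IntegrableOn (fun x => h x * φ x) (tsupport φ) μ :=
    (hh.integrableOn_compact_subset hs hc).mul_continuousOn hφ.continuousOn hc
  refine (integrableOn_iff_integrable_of_support_subset fun x hx => ?_).mp hK
  exact subset_tsupport φ (right_ne_zero_of_mul hx)

namespace IsTestOn

section NormedSpace

variable {E : Type*} [NormedAddCommGroup E] [NormedSpace ℝ E] {k : WithTop ℕ∞} {U : Set E}
  {φ p : E → ℝ}

theorem integrable_mul [MeasurableSpace E] [OpensMeasurableSpace E] {μ : Measure E} {h : E → ℝ}
    (hφ : IsTestOn k U φ) (hh : LocallyIntegrableOn h U μ) :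
    Integrable (fun x => h x * φ x) μ :=
  integrable_mul_of_tsupport_subset hh hφ.contDiff.continuous hφ.hasCompactSupport
    hφ.tsupport_subset

theorem integrable_mul_sq [MeasurableSpace E] [OpensMeasurableSpace E] {μ : Measure E} {h : E → ℝ}
    (hφ : IsTestOn k U φ) (hh : LocallyIntegrableOn h U μ) :
    Integrable (fun x => h x * φ x ^ 2) μ := by
  simpa only [sq, mul_assoc] using integrable_mul_of_tsupport_subset (φ := fun x => φ x * φ x) hh
    (hφ.contDiff.continuous.mul hφ.contDiff.continuous) hφ.hasCompactSupport.mul_left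
    (tsupport_mul_subset_left.trans hφ.tsupport_subset)

theorem contDiffOn_mul (hφ : IsTestOn k U φ) (hU : IsOpen U) (hp : ContDiffOn ℝ k p U) :
    IsTestOn k U (fun x => p x * φ x) where
  contDiff := contDiff_of_contDiffOn_of_tsupport_subset hU (hp.mul hφ.contDiff.contDiffOn)
    (tsupport_mul_subset_right.trans hφ.tsupport_subset)
  hasCompactSupport := hφ.hasCompactSupport.mul_left
  tsupport_subset := tsupport_mul_subset_right.trans hφ.tsupport_subset

end NormedSpace

section Line

variable {k : WithTop ℕ∞} {U : Set ℝ} {φ : ℝ → ℝ}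

theorem integrable_mul_deriv {h : ℝ → ℝ} (hφ : IsTestOn k U φ) (hk : k ≠ 0)
    (hh : LocallyIntegrableOn h U) : Integrable (fun x => h x * deriv φ x) :=
  integrable_mul_of_tsupport_subset hh
    (hφ.contDiff.continuous_deriv (ENat.one_le_iff_ne_zero_withTop.mpr hk))
    hφ.hasCompactSupport.deriv (tsupport_deriv_subset.trans hφ.tsupport_subset)

theorem integrable_mul_deriv_sq {h : ℝ → ℝ} (hφ : IsTestOn k U φ) (hk : k ≠ 0)
    (hh : LocallyIntegrableOn h U) : Integrable (fun x => h x * deriv φ x ^ 2) := by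
  have hc := hφ.contDiff.continuous_deriv (ENat.one_le_iff_ne_zero_withTop.mpr hk)
  simpa only [sq] using integrable_mul_of_tsupport_subset (φ := fun x => deriv φ x * deriv φ x) hh
    (hc.mul hc) hφ.hasCompactSupport.deriv.mul_left
    (tsupport_mul_subset_left.trans (tsupport_deriv_subset.trans hφ.tsupport_subset))

theorem integral_deriv_eq_zero (hφ : IsTestOn k U φ) (hk : k ≠ 0) : ∫ x, deriv φ x = 0 :=
  integral_eq_zero_of_hasDerivAt_of_integrable
    (fun x => (hφ.contDiff.differentiable hk x).hasDerivAt)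
    ((hφ.contDiff.continuous_deriv
      (ENat.one_le_iff_ne_zero_withTop.mpr hk)).integrable_of_hasCompactSupport
        hφ.hasCompactSupport.deriv)
    (hφ.contDiff.continuous.integrable_of_hasCompactSupport hφ.hasCompactSupport)

theorem exists_tsupport_subset_Ioo (hφ : IsTestOn k (Ioi 0) φ) :
    ∃ a b : ℝ, 0 < a ∧ a < 1 ∧ 1 < b ∧ tsupport φ ⊆ Ioo a b := by
  have hK : IsCompact (insert 1 (tsupport φ)) := hφ.hasCompactSupport.isCompact.insert 1
  obtain ⟨m, hm, hmin⟩ := hK.exists_isLeast (insert_nonempty _ _)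
  obtain ⟨M, -, hmax⟩ := hK.exists_isGreatest (insert_nonempty _ _)
  have hm0 : 0 < m := hm.elim (fun h => h ▸ one_pos) fun h => hφ.tsupport_subset h
  refine ⟨m / 2, M + 1, half_pos hm0, ?_, ?_, fun x hx => ⟨?_, ?_⟩⟩
  · linarith [hmin (mem_insert 1 _)]
  · linarith [hmax (mem_insert 1 _)]
  · linarith [hmin (mem_insert_of_mem _ hx)]
  · linarith [hmax (mem_insert_of_mem _ hx)]

end Line

end IsTestOn

protected theorem IsTestOn.fderiv_apply {E : Type*} [NormedAddCommGroup E] [NormedSpace ℝ E]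
    {U : Set E} {φ : E → ℝ} (hφ : IsTestOn ∞ U φ) (v : E) :
    IsTestOn ∞ U fun x => fderiv ℝ φ x v where
  contDiff := (hφ.contDiff.fderiv_right (m := ∞) (by simp)).clm_apply contDiff_const
  hasCompactSupport := hφ.hasCompactSupport.fderiv_apply ℝ v
  tsupport_subset := (tsupport_fderiv_apply_subset ℝ v).trans hφ.tsupport_subset

protected theorem IsTestOn.deriv {U : Set ℝ} {φ : ℝ → ℝ} (hφ : IsTestOn ∞ U φ) :
    IsTestOn ∞ U (deriv φ) := by
  simpa only [fderiv_apply_one_eq_deriv] using hφ.fderiv_apply 1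

theorem integral_eq_intervalIntegral_of_tsupport_subset {F φ : ℝ → ℝ} {a b : ℝ}
    (hs : tsupport φ ⊆ Ioo a b) (hF : ∀ x, F x ≠ 0 → x ∈ tsupport φ) :
    ∫ x, F x = ∫ x in a..b, F x :=
  (intervalIntegral.integral_eq_integral_of_support_subset fun x hx =>
    Ioo_subset_Ioc_self (hs (hF x hx))).symm

/-! ### Weak derivatives on the half-line -/

theorem exists_isTestOn_integral_eq_one :
    ∃ φ : ℝ → ℝ, IsTestOn ∞ (Ioi 0) φ ∧ ∫ x, φ x = 1 := by
  let β : ContDiffBump (1 : ℝ) := ⟨1 / 4, 1 / 2, by norm_num, by norm_num⟩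
  refine ⟨β.normed volume, ⟨β.contDiff_normed, β.hasCompactSupport_normed, ?_⟩, β.integral_normed⟩
  rw [β.tsupport_normed_eq, Real.closedBall_eq_Icc]
  exact fun x hx => lt_of_lt_of_le (by norm_num) hx.1

theorem IsTestOn.exists_primitive {ρ : ℝ → ℝ} (hρ : IsTestOn ∞ (Ioi 0) ρ) (h0 : ∫ x, ρ x = 0) :
    ∃ Φ, IsTestOn ∞ (Ioi 0) Φ ∧ deriv Φ = ρ := by
  obtain ⟨a, b, ha, _, _, hs⟩ := hρ.exists_tsupport_subset_Ioo
  have hρc := hρ.contDiff.continuous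
  have hzero : ∀ x, x ∉ Ioo a b → ρ x = 0 := fun x hx =>
    image_eq_zero_of_notMem_tsupport fun h => hx (hs h)
  let Φ : ℝ → ℝ := fun x => ∫ t in a..x, ρ t
  have hΦd : ∀ x, HasDerivAt Φ (ρ x) x := fun x => hρc.integral_hasStrictDerivAt a x |>.hasDerivAt
  have hΦ' : deriv Φ = ρ := funext fun x => (hΦd x).deriv
  have hsupp : Function.support Φ ⊆ Icc a b := by
    intro x hx
    by_contra hxab
    rcases lt_or_ge x a with hxa | hxa
    · refine hx ((intervalIntegral.integral_congr fun t ht => hzero t fun h => ?_).trans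
        intervalIntegral.integral_zero)
      rw [uIcc_of_ge hxa.le] at ht
      exact absurd h.1 (not_lt.mpr ht.2)
    · have hbx : b < x := not_le.mp fun h => hxab ⟨hxa, h⟩
      refine hx ((intervalIntegral.integral_eq_integral_of_support_subset fun t ht => ?_).trans h0)
      have := hs (subset_tsupport ρ ht)
      exact ⟨this.1, (this.2.trans hbx).le⟩
  have htsupp : tsupport Φ ⊆ Icc a b := closure_minimal hsupp isClosed_Icc
  exact ⟨Φ, ⟨contDiff_infty_iff_deriv.mpr ⟨fun x => (hΦd x).differentiableAt, hΦ' ▸ hρ.contDiff⟩,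
    HasCompactSupport.of_support_subset_isCompact isCompact_Icc hsupp,
    htsupp.trans fun x hx => lt_of_lt_of_le ha hx.1⟩, hΦ'⟩

/-- The lemma of du Bois-Reymond. -/
theorem ae_eq_const_of_integral_mul_deriv_eq_zero {Q : ℝ → ℝ}
    (hQ : LocallyIntegrableOn Q (Ioi 0))
    (h : ∀ φ, IsTestOn ∞ (Ioi 0) φ → ∫ x, Q x * deriv φ x = 0) :
    ∃ c, ∀ᵐ x, x ∈ Ioi (0 : ℝ) → Q x = c := by
  obtain ⟨φ₀, hφ₀, hφ₀1⟩ := exists_isTestOn_integral_eq_one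
  set c := ∫ x, Q x * φ₀ x
  have hzero : ∀ᵐ x, x ∈ Ioi (0 : ℝ) → Q x - c = 0 := by
    refine isOpen_Ioi.ae_eq_zero_of_integral_contDiff_smul_eq_zero
      (hQ.sub (continuousOn_const.locallyIntegrableOn measurableSet_Ioi)) fun ψ hψ hψc hψs => ?_
    have hψt : IsTestOn ∞ (Ioi 0) ψ := ⟨hψ, hψc, hψs⟩
    have hψi : Integrable ψ := hψ.continuous.integrable_of_hasCompactSupport hψc
    have hφ₀i : Integrable φ₀ :=
      hφ₀.contDiff.continuous.integrable_of_hasCompactSupport hφ₀.hasCompactSupport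
    set m := ∫ x, ψ x
    obtain ⟨Φ, hΦ, hΦ'⟩ : ∃ Φ, IsTestOn ∞ (Ioi 0) Φ ∧ deriv Φ = fun x => ψ x - m * φ₀ x := by
      refine IsTestOn.exists_primitive ⟨hψ.sub (contDiff_const.mul hφ₀.contDiff),
        hψc.sub hφ₀.hasCompactSupport.mul_left, (tsupport_sub _ _).trans (union_subset hψs
          (tsupport_mul_subset_right.trans hφ₀.tsupport_subset))⟩ ?_
      rw [integral_sub hψi (hφ₀i.const_mul m), integral_const_mul, hφ₀1, mul_one, sub_self]
    have hmean : (∫ x, Q x * ψ x) - m * c = 0 := by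
      have hΦ0 := h Φ hΦ
      simp only [hΦ', mul_sub, mul_left_comm _ m] at hΦ0
      rwa [integral_sub (hψt.integrable_mul hQ) ((hφ₀.integrable_mul hQ).const_mul m),
        integral_const_mul] at hΦ0
    simp only [smul_eq_mul, mul_comm (ψ _), sub_mul]
    rw [integral_sub (hψt.integrable_mul hQ) (hψi.const_mul c), integral_const_mul, mul_comm c]
    exact hmean
  exact ⟨c, hzero.mono fun x hx h0 => sub_eq_zero.mp (hx h0)⟩

section Primitive

variable {H : ℝ → ℝ}

theorem intervalIntegrable_of_locallyIntegrableOn_Ioi (hH : LocallyIntegrableOn H (Ioi 0))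
    {a b : ℝ} (ha : 0 < a) (hb : 0 < b) : IntervalIntegrable H volume a b :=
  (hH.integrableOn_compact_subset (fun _ hx => lt_of_lt_of_le (lt_min ha hb) hx.1)
    isCompact_uIcc).intervalIntegrable

theorem absolutelyContinuousOnInterval_primitive (hH : LocallyIntegrableOn H (Ioi 0))
    {a b : ℝ} (ha : 0 < a) (ha1 : a ≤ 1) (hb : 1 ≤ b) :
    AbsolutelyContinuousOnInterval (fun x => ∫ t in (1 : ℝ)..x, H t) a b :=
  (intervalIntegrable_of_locallyIntegrableOn_Ioi hH ha
    (one_pos.trans_le hb)).absolutelyContinuousOnInterval_intervalIntegral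
      (by rw [uIcc_of_le (ha1.trans hb)]; exact ⟨ha1, hb⟩)

theorem continuousOn_primitive (hH : LocallyIntegrableOn H (Ioi 0)) :
    ContinuousOn (fun x => ∫ t in (1 : ℝ)..x, H t) (Ioi 0) := by
  intro x (hx : 0 < x)
  have hac := absolutelyContinuousOnInterval_primitive hH (lt_min (half_pos hx) one_pos)
    (min_le_right (x / 2) 1) (le_max_right (x + 1) 1)
  refine (hac.continuousOn.continuousAt ?_).continuousWithinAt
  rw [uIcc_of_le ((min_le_right _ _).trans (le_max_right _ _))]
  exact Icc_mem_nhds ((min_le_left _ _).trans_lt (half_lt_self hx))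
    ((lt_add_one x).trans_le (le_max_left _ _))

theorem integral_primitive_mul_deriv (hH : LocallyIntegrableOn H (Ioi 0)) {φ : ℝ → ℝ}
    (hφ : IsTestOn ∞ (Ioi 0) φ) :
    ∫ x, (∫ t in (1 : ℝ)..x, H t) * deriv φ x = -∫ x, H x * φ x := by
  obtain ⟨a, b, ha, ha1, hb, hs⟩ := hφ.exists_tsupport_subset_Ioo
  have hab : a < b := ha1.trans hb
  have hφa : φ a = 0 := image_eq_zero_of_notMem_tsupport fun h => lt_irrefl a (hs h).1
  have hφb : φ b = 0 := image_eq_zero_of_notMem_tsupport fun h => lt_irrefl b (hs h).2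
  have hφac : AbsolutelyContinuousOnInterval φ a b :=
    (hφ.contDiff.of_le (by simp)).contDiffOn.absolutelyContinuousOnInterval
  have hparts := (absolutelyContinuousOnInterval_primitive hH ha ha1.le
    hb.le).integral_mul_deriv_eq_deriv_mul hφac
  rw [hφa, hφb, mul_zero, mul_zero, sub_zero, zero_sub] at hparts
  rw [integral_eq_intervalIntegral_of_tsupport_subset hs fun x hx =>
      support_deriv_subset (right_ne_zero_of_mul hx), hparts,
    integral_eq_intervalIntegral_of_tsupport_subset hs fun x hx =>
      subset_tsupport φ (right_ne_zero_of_mul hx)]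
  congr 1
  apply intervalIntegral.integral_congr_ae
  filter_upwards [(intervalIntegrable_of_locallyIntegrableOn_Ioi hH ha
    (one_pos.trans hb)).ae_hasDerivAt_integral] with x hx hx'
  rw [(hx (uIoc_subset_uIcc hx') 1 (by rw [uIcc_of_le hab.le]; exact ⟨ha1.le, hb.le⟩)).deriv]

theorem ae_eq_primitive_of_weakDeriv {P : ℝ → ℝ} (hP : LocallyIntegrableOn P (Ioi 0))
    (hH : LocallyIntegrableOn H (Ioi 0))
    (h : ∀ φ, IsTestOn ∞ (Ioi 0) φ → ∫ x, P x * deriv φ x = -∫ x, H x * φ x) :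
    ∃ c, ∀ᵐ x, x ∈ Ioi (0 : ℝ) → P x = c + ∫ t in (1 : ℝ)..x, H t := by
  have hI : LocallyIntegrableOn (fun x => ∫ t in (1 : ℝ)..x, H t) (Ioi 0) :=
    (continuousOn_primitive hH).locallyIntegrableOn measurableSet_Ioi
  obtain ⟨c, hc⟩ := ae_eq_const_of_integral_mul_deriv_eq_zero (hP.sub hI) fun φ hφ => by
    simp only [Pi.sub_apply, sub_mul]
    rw [integral_sub (hφ.integrable_mul_deriv (by simp) hP)
      (hφ.integrable_mul_deriv (by simp) hI), h φ hφ, integral_primitive_mul_deriv hH hφ, sub_self]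
  exact ⟨c, hc.mono fun x hx h0 => sub_eq_iff_eq_add.mp (hx h0)⟩

theorem hasDerivAt_primitive (hH : ContinuousOn H (Ioi 0)) (c : ℝ) {x : ℝ} (hx : 0 < x) :
    HasDerivAt (fun x => c + ∫ t in (1 : ℝ)..x, H t) (H x) x := by
  have hs : uIcc 1 x ⊆ Ioi (0 : ℝ) := fun y hy => lt_of_lt_of_le (lt_min one_pos hx) hy.1
  exact (intervalIntegral.integral_hasDerivAt_right (hH.mono hs).intervalIntegrable
    (hH.stronglyMeasurableAtFilter isOpen_Ioi x hx)
    (hH.continuousAt (Ioi_mem_nhds hx))).const_add c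

end Primitive

theorem hasDerivAt_of_weakDeriv_of_continuousOn {P H : ℝ → ℝ} (hP : ContinuousOn P (Ioi 0))
    (hH : ContinuousOn H (Ioi 0))
    (h : ∀ φ, IsTestOn ∞ (Ioi 0) φ → ∫ x, P x * deriv φ x = -∫ x, H x * φ x) {x : ℝ}
    (hx : 0 < x) : HasDerivAt P (H x) x := by
  have hHl : LocallyIntegrableOn H (Ioi 0) := hH.locallyIntegrableOn measurableSet_Ioi
  obtain ⟨c, hc⟩ := ae_eq_primitive_of_weakDeriv (hP.locallyIntegrableOn measurableSet_Ioi) hHl h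
  have heq : EqOn P (fun x => c + ∫ t in (1 : ℝ)..x, H t) (Ioi 0) :=
    Measure.eqOn_open_of_ae_eq ((ae_restrict_iff' measurableSet_Ioi).mpr hc) isOpen_Ioi hP
      (continuousOn_const.add (continuousOn_primitive hHl))
  exact (hasDerivAt_primitive hH c hx).congr_of_eventuallyEq
    (heq.eventuallyEq_of_mem (Ioi_mem_nhds hx))

/-! ### Mollification -/

section Bump

variable {E : Type*} [NormedAddCommGroup E] [NormedSpace ℝ E] [FiniteDimensional ℝ E]
  [MeasurableSpace E] [BorelSpace E] {μ : Measure E} [μ.IsAddHaarMeasure]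
  (β : ContDiffBump (0 : E)) {q : E → ℝ}

theorem abs_normed_convolution_le (hq : AEStronglyMeasurable q μ) {C : ℝ} (hC : 0 ≤ C) {x : E}
    (h : ∀ y ∈ Metric.ball x β.rOut, |q y| ≤ C) :
    |(β.normed μ ⋆[ContinuousLinearMap.lsmul ℝ ℝ, μ] q) x| ≤ C := by
  rw [← Real.dist_0_eq_abs]
  exact dist_convolution_le hC β.support_normed_eq.subset β.nonneg_normed β.integral_normed hq
    fun y hy => (Real.dist_0_eq_abs (q y)).trans_le (h y hy)

theorem normed_convolution_eq_zero (hq : AEStronglyMeasurable q μ) {δ : ℝ} (hδ : β.rOut ≤ δ) {x : E}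
    (hx : x ∉ Metric.cthickening δ (tsupport q)) :
    (β.normed μ ⋆[ContinuousLinearMap.lsmul ℝ ℝ, μ] q) x = 0 := by
  refine abs_nonpos_iff.mp (abs_normed_convolution_le β hq le_rfl fun y hy => ?_)
  rw [abs_nonpos_iff]
  by_contra hne
  refine hx (Metric.mem_cthickening_of_dist_le x y δ _ (subset_tsupport q hne) ?_)
  rw [dist_comm]
  exact (Metric.mem_ball.mp hy).le.trans hδ

end Bump

theorem exists_contDiffBump_tendsto_rOut (E : Type*) [NormedAddCommGroup E] [NormedSpace ℝ E]
    {δ : ℝ} (hδ : 0 < δ) :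
    ∃ β : ℕ → ContDiffBump (0 : E), (∀ k, (β k).rOut ≤ δ) ∧
      Tendsto (fun k => (β k).rOut) atTop (𝓝 0) := by
  refine ⟨fun k => ⟨δ * (1 / ((k : ℝ) + 1)) / 2, δ * (1 / ((k : ℝ) + 1)), by positivity,
    half_lt_self (by positivity)⟩, fun k => ?_, ?_⟩
  · exact mul_le_of_le_one_right hδ.le (by
      rw [div_le_one (by positivity)]; exact le_add_of_nonneg_left k.cast_nonneg)
  · simpa only [mul_zero] using
      (tendsto_one_div_add_atTop_nhds_zero_nat (𝕜 := ℝ)).const_mul δ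

theorem IsTestOn.exists_smooth_approx {U : Set ℝ} (hU : IsOpen U) {q : ℝ → ℝ}
    (hq : IsTestOn 1 U q) :
    ∃ (Q : ℕ → ℝ → ℝ) (K : Set ℝ) (C : ℝ), IsCompact K ∧ K ⊆ U ∧ (∀ k, IsTestOn ∞ U (Q k)) ∧
      (∀ k, tsupport (Q k) ⊆ K) ∧ (∀ k x, |Q k x| ≤ C) ∧ (∀ k x, |deriv (Q k) x| ≤ C) ∧
      (∀ x, Tendsto (fun k => Q k x) atTop (𝓝 (q x))) ∧
      ∀ x, Tendsto (fun k => deriv (Q k) x) atTop (𝓝 (deriv q x)) := by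
  have hqc : Continuous q := hq.contDiff.continuous
  have hdc : Continuous (deriv q) := hq.contDiff.continuous_deriv le_rfl
  obtain ⟨C₀, hC₀⟩ := hq.hasCompactSupport.exists_bound_of_continuous hqc
  obtain ⟨C₁, hC₁⟩ := hq.hasCompactSupport.deriv.exists_bound_of_continuous hdc
  obtain ⟨δ, hδ, hδU⟩ :=
    hq.hasCompactSupport.isCompact.exists_cthickening_subset_open hU hq.tsupport_subset
  obtain ⟨β, hβδ, hβ⟩ := exists_contDiffBump_tendsto_rOut ℝ hδ
  set K : Set ℝ := Metric.cthickening δ (tsupport q)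
  have hK : IsCompact K := hq.hasCompactSupport.isCompact.cthickening
  let Q : ℕ → ℝ → ℝ := fun k =>
    (β k).normed volume ⋆[ContinuousLinearMap.lsmul ℝ ℝ, volume] q
  have hQ' : ∀ k x, deriv (Q k) x =
      ((β k).normed volume ⋆[ContinuousLinearMap.lsmul ℝ ℝ, volume] deriv q) x := fun k x =>
    (hq.hasCompactSupport.hasDerivAt_convolution_right _
      (β k).continuous_normed.locallyIntegrable hq.contDiff x).deriv
  have hsupp : ∀ k, Function.support (Q k) ⊆ K := fun k x hx => by
    by_contra hxK
    exact hx (normed_convolution_eq_zero (β k) hqc.aestronglyMeasurable (hβδ k) hxK)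
  have htsupp : ∀ k, tsupport (Q k) ⊆ K := fun k => closure_minimal (hsupp k) hK.isClosed
  have hQ : ∀ k, ContDiff ℝ ∞ (Q k) := fun k =>
    (β k).hasCompactSupport_normed.contDiff_convolution_left _ (β k).contDiff_normed
      hqc.locallyIntegrable
  refine ⟨Q, K, max C₀ C₁, hK, hδU, fun k => ⟨hQ k,
    HasCompactSupport.of_support_subset_isCompact hK (hsupp k), (htsupp k).trans hδU⟩, htsupp,
    fun k x => ?_, fun k x => ?_, fun x => ?_, fun x => ?_⟩
  · exact abs_normed_convolution_le _ hqc.aestronglyMeasurable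
      (((norm_nonneg _).trans (hC₀ 0)).trans (le_max_left _ _))
      fun y _ => (hC₀ y).trans (le_max_left _ _)
  · rw [hQ']
    exact abs_normed_convolution_le _ hdc.aestronglyMeasurable
      (((norm_nonneg _).trans (hC₀ 0)).trans (le_max_left _ _))
      fun y _ => (hC₁ y).trans (le_max_right _ _)
  · exact ContDiffBump.convolution_tendsto_right_of_continuous hβ hqc x
  · simp only [hQ']
    exact ContDiffBump.convolution_tendsto_right_of_continuous hβ hdc x

theorem tendsto_integral_mul_sq {X : Type*} [TopologicalSpace X] [T2Space X] [MeasurableSpace X]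
    [OpensMeasurableSpace X] {μ : Measure X} {U K : Set X} {A : X → ℝ}
    (hA : LocallyIntegrableOn A U μ) (hK : IsCompact K) (hKU : K ⊆ U) {Q : ℕ → X → ℝ} {q : X → ℝ}
    {C : ℝ} (hQ : ∀ k, Continuous (Q k)) (hs : ∀ k, tsupport (Q k) ⊆ K) (hC : ∀ k x, |Q k x| ≤ C)
    (hlim : ∀ x, Tendsto (fun k => Q k x) atTop (𝓝 (q x))) :
    Tendsto (fun k => ∫ x, A x * Q k x ^ 2 ∂μ) atTop (𝓝 (∫ x, A x * q x ^ 2 ∂μ)) := by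
  have hAK : IntegrableOn A K μ := hA.integrableOn_compact_subset hKU hK
  have hs2 : ∀ k, tsupport (fun x => Q k x ^ 2) ⊆ K := fun k =>
    (closure_mono fun x hx => ne_zero_pow two_ne_zero hx).trans (hs k)
  refine tendsto_integral_of_dominated_convergence (K.indicator fun x => |A x| * C ^ 2)
    (fun k => ?_) ?_ (fun k => ae_of_all _ fun x => ?_)
    (ae_of_all _ fun x => ((hlim x).pow 2).const_mul _)
  · exact (integrable_mul_of_tsupport_subset hA ((hQ k).pow 2)
      (HasCompactSupport.of_support_subset_isCompact hK ((subset_tsupport _).trans (hs2 k)))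
      ((hs2 k).trans hKU)).aestronglyMeasurable
  · exact (integrable_indicator_iff hK.measurableSet).mpr (hAK.norm.mul_const _)
  · by_cases hx : x ∈ K
    · rw [indicator_of_mem hx, Real.norm_eq_abs, abs_mul, abs_pow]
      gcongr
      exact hC k x
    · rw [indicator_of_notMem hx, image_eq_zero_of_notMem_tsupport fun h => hx (hs k h)]
      simp

theorem quadratic_le_of_smooth {U : Set ℝ} (hU : IsOpen U) {A B : ℝ → ℝ}
    (hA : LocallyIntegrableOn A U) (hB : LocallyIntegrableOn B U)
    (h : ∀ q, IsTestOn ∞ U q → ∫ x, A x * q x ^ 2 ≤ ∫ x, B x * deriv q x ^ 2)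
    {q : ℝ → ℝ} (hq : IsTestOn 1 U q) :
    ∫ x, A x * q x ^ 2 ≤ ∫ x, B x * deriv q x ^ 2 := by
  obtain ⟨Q, K, C, hK, hKU, hQ, hs, hC, hC', hlim, hlim'⟩ := hq.exists_smooth_approx hU
  exact le_of_tendsto_of_tendsto'
    (tendsto_integral_mul_sq hA hK hKU (fun k => (hQ k).contDiff.continuous) hs hC hlim)
    (tendsto_integral_mul_sq hB hK hKU (fun k => (hQ k).contDiff.continuous_deriv (by simp))
      (fun k => tsupport_deriv_subset.trans (hs k)) hC' hlim') fun k => h _ (hQ k)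

/-! ### The radial equation and its stability inequality -/

/-- The flux `t / √(1 + t²)` of the mean curvature operator in one variable. -/
def mcFlux (t : ℝ) : ℝ := t / √(1 + t ^ 2)

/-- The weight `t² / (1 + t²)^{3/2}` which appears when the stability inequality is tested with
multiples of the radial derivative. -/
def jacobiWeight (t : ℝ) : ℝ := t ^ 2 / √(1 + t ^ 2) ^ 3

theorem sqrt_one_add_sq_pos (t : ℝ) : 0 < √(1 + t ^ 2) := Real.sqrt_pos.mpr (by positivity)

theorem one_le_sqrt_one_add_sq (t : ℝ) : 1 ≤ √(1 + t ^ 2) :=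
  Real.one_le_sqrt.mpr (le_add_of_nonneg_right (sq_nonneg t))

theorem sq_sqrt_one_add_sq (t : ℝ) : √(1 + t ^ 2) ^ 2 = 1 + t ^ 2 :=
  Real.sq_sqrt (by positivity)

theorem continuous_sqrt_one_add_sq : Continuous fun t : ℝ => √(1 + t ^ 2) := by fun_prop

theorem continuous_jacobiWeight : Continuous jacobiWeight :=
  (continuous_pow 2).div (continuous_sqrt_one_add_sq.pow 3) fun t =>
    pow_ne_zero 3 (sqrt_one_add_sq_pos t).ne'

theorem univUnitBall_eq_mcFlux (t : ℝ) : OpenPartialHomeomorph.univUnitBall t = mcFlux t := by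
  rw [OpenPartialHomeomorph.univUnitBall_apply, Real.norm_eq_abs, sq_abs, smul_eq_mul, mcFlux,
    div_eq_inv_mul]

theorem continuous_mcFlux : Continuous mcFlux :=
  continuous_id.div continuous_sqrt_one_add_sq fun t => (sqrt_one_add_sq_pos t).ne'

theorem hasDerivAt_mcFlux (t : ℝ) : HasDerivAt mcFlux (1 / √(1 + t ^ 2) ^ 3) t := by
  have hS := sqrt_one_add_sq_pos t
  have hS2 := sq_sqrt_one_add_sq t
  have hsqrt : HasDerivAt (fun t : ℝ => √(1 + t ^ 2)) (2 * t / (2 * √(1 + t ^ 2))) t := by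
    simpa using ((hasDerivAt_pow 2 t).const_add 1).sqrt (by positivity)
  refine ((hasDerivAt_id t).div hsqrt hS.ne').congr_deriv ?_
  simp only [id]
  field_simp
  linear_combination hS2

/-- `mcFlux` is a diffeomorphism onto `(-1, 1)`. -/
theorem contDiffOn_of_mcFlux_comp {E : Type*} [NormedAddCommGroup E] [NormedSpace ℝ E]
    {k : ℕ∞} {s : Set E} {p : E → ℝ} (h : ContDiffOn ℝ k (fun x => mcFlux (p x)) s) :
    ContDiffOn ℝ k p s := by
  have hmem : ∀ t, mcFlux t ∈ Metric.ball (0 : ℝ) 1 := fun t => by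
    rw [← univUnitBall_eq_mcFlux]
    exact OpenPartialHomeomorph.univUnitBall.map_source (mem_univ t)
  refine (OpenPartialHomeomorph.contDiffOn_univUnitBall_symm.comp h fun x _ => hmem _).congr
    fun x _ => ?_
  rw [Function.comp_apply, ← univUnitBall_eq_mcFlux]
  exact (OpenPartialHomeomorph.univUnitBall.left_inv (mem_univ _)).symm

/-- The function `u(x) = g(|x|)` solves the mean curvature equation on `ℝ^(N+1) ∖ {0}`, written as
an ordinary differential equation for the profile `g` and its derivative `p`. -/
structure IsRadialSolution (N : ℕ) (f g p : ℝ → ℝ) : Prop where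
  hasDerivAt : ∀ r ∈ Ioi (0 : ℝ), HasDerivAt g (p r) r
  continuousOn : ContinuousOn p (Ioi 0)
  hasDerivAt_flux : ∀ r ∈ Ioi (0 : ℝ),
    HasDerivAt (fun r => r ^ N * mcFlux (p r)) (-(r ^ N * f (g r))) r

/-- The flux `r ^ N * (mcFlux ∘ p)'(r)` of the linearised radial equation, with the derivative
eliminated by means of the equation. -/
def jacobiFlux (N : ℕ) (f g p : ℝ → ℝ) (r : ℝ) : ℝ :=
  -(r ^ N * f (g r)) - N / r * (r ^ N * mcFlux (p r))

theorem hasDerivAt_pow_div (N : ℕ) {r : ℝ} (hr : r ≠ 0) :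
    HasDerivAt (fun r : ℝ => r ^ N) (N / r * r ^ N) r := by
  refine (hasDerivAt_pow N r).congr_deriv ?_
  rcases N with _ | N
  · simp
  · rw [Nat.add_sub_cancel, pow_succ]
    field_simp

theorem continuousOn_pow_mul (N : ℕ) {s : Set ℝ} {F : ℝ → ℝ} (hF : ContinuousOn F s) :
    ContinuousOn (fun r => r ^ N * F r) s :=
  (continuous_pow N).continuousOn.mul hF

/-- The integrand `c (η / r)² - η'²` of a one-dimensional Hardy inequality with constant `c`,
without the weight. -/
def hardyDensity (c : ℝ) (η : ℝ → ℝ) (r : ℝ) : ℝ := c * η r ^ 2 / r ^ 2 - deriv η r ^ 2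

theorem IsTestOn.integrable_mul_hardyDensity {w η : ℝ → ℝ} (hη : IsTestOn 1 (Ioi 0) η)
    (hw : ContinuousOn w (Ioi 0)) (c : ℝ) : Integrable fun r => w r * hardyDensity c η r := by
  have hw' : ContinuousOn (fun r => w r * (c / r ^ 2)) (Ioi 0) :=
    hw.mul (continuousOn_const.div (continuous_pow 2).continuousOn fun r hr =>
      pow_ne_zero 2 (ne_of_gt hr))
  refine ((hη.integrable_mul_sq (hw'.locallyIntegrableOn measurableSet_Ioi)).sub
    (hη.integrable_mul_deriv_sq one_ne_zero (hw.locallyIntegrableOn measurableSet_Ioi))).congr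
    (ae_of_all _ fun r => ?_)
  simp only [Pi.sub_apply, hardyDensity]
  ring

namespace IsRadialSolution

variable {N : ℕ} {f g p η : ℝ → ℝ} {r : ℝ}

theorem contDiffOn_comp (h : IsRadialSolution N f g p) (hf : ContDiff ℝ 1 f) :
    ContDiffOn ℝ 1 (fun r => f (g r)) (Ioi 0) :=
  hf.comp_contDiffOn (contDiffOn_one_of_hasDerivAt isOpen_Ioi h.hasDerivAt h.continuousOn)

theorem contDiffOn_flux (h : IsRadialSolution N f g p) (hf : ContDiff ℝ 1 f) :
    ContDiffOn ℝ 1 (fun r => r ^ N * mcFlux (p r)) (Ioi 0) :=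
  contDiffOn_one_of_hasDerivAt isOpen_Ioi h.hasDerivAt_flux
    ((continuous_pow N).continuousOn.mul (h.contDiffOn_comp hf).continuousOn).neg

theorem contDiffOn_slope (h : IsRadialSolution N f g p) (hf : ContDiff ℝ 1 f) :
    ContDiffOn ℝ 1 p (Ioi 0) := by
  refine contDiffOn_of_mcFlux_comp (k := 1) (((h.contDiffOn_flux hf).div
    (contDiff_id.pow N).contDiffOn fun r hr => pow_ne_zero N (ne_of_gt hr)).congr fun r hr => ?_)
  exact (mul_div_cancel_left₀ _ (pow_ne_zero N (ne_of_gt hr))).symm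

theorem hasDerivAt_slope (h : IsRadialSolution N f g p) (hf : ContDiff ℝ 1 f) (hr : 0 < r) :
    HasDerivAt p (deriv p r) r :=
  (((h.contDiffOn_slope hf).differentiableOn one_ne_zero).differentiableAt
    (Ioi_mem_nhds hr)).hasDerivAt

theorem jacobiFlux_eq (h : IsRadialSolution N f g p) (hf : ContDiff ℝ 1 f) (hr : 0 < r) :
    jacobiFlux N f g p r = r ^ N * (deriv p r / √(1 + p r ^ 2) ^ 3) := by
  have hflux := (hasDerivAt_pow_div N hr.ne').mul
    ((hasDerivAt_mcFlux (p r)).comp r (h.hasDerivAt_slope hf hr))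
  have heq := (h.hasDerivAt_flux r hr).unique hflux
  simp only [Function.comp_apply] at heq
  rw [jacobiFlux, heq]
  ring

theorem hasDerivAt_jacobiFlux (h : IsRadialSolution N f g p) (hf : ContDiff ℝ 1 f) (hr : 0 < r) :
    HasDerivAt (jacobiFlux N f g p)
      (N / r ^ 2 * (r ^ N * mcFlux (p r)) - r ^ N * (deriv f (g r) * p r)) r := by
  have hfg := ((hf.differentiable one_ne_zero) (g r)).hasDerivAt.comp r (h.hasDerivAt r hr)
  have hN : HasDerivAt (fun r : ℝ => N / r) (-N / r ^ 2) r := by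
    simpa only [div_eq_mul_inv, mul_neg, neg_mul] using (hasDerivAt_inv hr.ne').const_mul (N : ℝ)
  refine (((hasDerivAt_pow_div N hr.ne').mul hfg).neg.sub
    (hN.mul (h.hasDerivAt_flux r hr))).congr_deriv ?_
  simp only [Function.comp_apply]
  field_simp
  ring

theorem contDiffOn_jacobiFlux (h : IsRadialSolution N f g p) (hf : ContDiff ℝ 1 f) :
    ContDiffOn ℝ 1 (jacobiFlux N f g p) (Ioi 0) :=
  ((contDiff_id.pow N).contDiffOn.mul (h.contDiffOn_comp hf)).neg.sub
    ((contDiffOn_const.div contDiffOn_id fun _ hr => ne_of_gt hr).mul (h.contDiffOn_flux hf))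

/-- The radial derivative `p` nearly solves the linearised equation, so that the stability form of
`p * η` agrees, up to an exact derivative, with a quadratic form in `η` alone. -/
theorem deriv_jacobiFlux_mul (h : IsRadialSolution N f g p) (hf : ContDiff ℝ 1 f)
    (hη : DifferentiableAt ℝ η r) (hr : 0 < r) :
    deriv (fun r => jacobiFlux N f g p r * p r * η r ^ 2) r =
      r ^ N * (N * (p r ^ 2 / √(1 + p r ^ 2)) * η r ^ 2 / r ^ 2 -
        jacobiWeight (p r) * deriv η r ^ 2)
      + (r ^ N * (1 / √(1 + p r ^ 2) ^ 3) * deriv (fun r => p r * η r) r ^ 2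
        - r ^ N * deriv f (g r) * (p r * η r) ^ 2) := by
  have hp := h.hasDerivAt_slope hf hr
  have hF : HasDerivAt (fun r => jacobiFlux N f g p r * p r * η r ^ 2) _ r :=
    ((h.hasDerivAt_jacobiFlux hf hr).mul hp).mul (hη.hasDerivAt.pow 2)
  have hq : HasDerivAt (fun r => p r * η r) _ r := hp.mul hη.hasDerivAt
  rw [hF.deriv, hq.deriv]
  simp only [Pi.mul_apply, h.jacobiFlux_eq hf hr, mcFlux, jacobiWeight]
  field_simp
  ring

theorem hardyDensity_add_stabilityForm_le (h : IsRadialSolution N f g p) (hf : ContDiff ℝ 1 f)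
    (hη : DifferentiableAt ℝ η r) (hr : 0 < r) :
    r ^ N * jacobiWeight (p r) * hardyDensity N η r
      + (r ^ N * (1 / √(1 + p r ^ 2) ^ 3) * deriv (fun r => p r * η r) r ^ 2
        - r ^ N * deriv f (g r) * (p r * η r) ^ 2) ≤
      deriv (fun r => jacobiFlux N f g p r * p r * η r ^ 2) r := by
  rw [h.deriv_jacobiFlux_mul hf hη hr, mul_assoc, hardyDensity, mul_sub (jacobiWeight (p r)),
    add_le_add_iff_right]
  have hle : jacobiWeight (p r) ≤ p r ^ 2 / √(1 + p r ^ 2) :=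
    div_le_div_of_nonneg_left (sq_nonneg _) (sqrt_one_add_sq_pos _)
      (le_self_pow₀ (one_le_sqrt_one_add_sq _) three_ne_zero)
  refine mul_le_mul_of_nonneg_left (sub_le_sub_right ?_ _) (pow_nonneg hr.le N)
  calc jacobiWeight (p r) * (N * η r ^ 2 / r ^ 2)
      ≤ p r ^ 2 / √(1 + p r ^ 2) * (N * η r ^ 2 / r ^ 2) := by gcongr
    _ = N * (p r ^ 2 / √(1 + p r ^ 2)) * η r ^ 2 / r ^ 2 := by ring

theorem of_weak (hp : ContinuousOn p (Ioi 0)) (hg : ∀ r ∈ Ioi (0 : ℝ), HasDerivAt g (p r) r)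
    (hf : Continuous f)
    (heq : ∀ φ, IsTestOn ∞ (Ioi 0) φ →
      ∫ r, r ^ N * mcFlux (p r) * deriv φ r = ∫ r, r ^ N * f (g r) * φ r) :
    IsRadialSolution N f g p where
  hasDerivAt := hg
  continuousOn := hp
  hasDerivAt_flux r hr := by
    have hgc : ContinuousOn g (Ioi 0) := fun r hr => (hg r hr).continuousAt.continuousWithinAt
    refine hasDerivAt_of_weakDeriv_of_continuousOn
      (P := fun r => r ^ N * mcFlux (p r)) (H := fun r => -(r ^ N * f (g r)))
      (continuousOn_pow_mul N (continuous_mcFlux.comp_continuousOn hp))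
      (continuousOn_pow_mul N (hf.comp_continuousOn hgc)).neg (fun φ hφ => ?_) hr
    simp only [heq φ hφ, neg_mul, integral_neg, neg_neg]

/-- Testing stability with `p * η` gives a Hardy inequality with constant `N`. -/
theorem hardy_of_stable (h : IsRadialSolution N f g p) (hf : ContDiff ℝ 1 f)
    (hst : ∀ q, IsTestOn ∞ (Ioi 0) q →
      ∫ r, r ^ N * deriv f (g r) * q r ^ 2 ≤
        ∫ r, r ^ N * (1 / √(1 + p r ^ 2) ^ 3) * deriv q r ^ 2)
    (hη : IsTestOn 1 (Ioi 0) η) :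
    ∫ r, r ^ N * jacobiWeight (p r) * hardyDensity N η r ≤ 0 := by
  have hq : IsTestOn 1 (Ioi 0) fun r => p r * η r :=
    hη.contDiffOn_mul isOpen_Ioi (h.contDiffOn_slope hf)
  have hF : IsTestOn 1 (Ioi 0) fun r => jacobiFlux N f g p r * p r * η r ^ 2 := by
    simpa only [sq, mul_assoc, mul_comm (η _)] using hq.contDiffOn_mul isOpen_Ioi
      ((h.contDiffOn_jacobiFlux hf).mul hη.contDiff.contDiffOn)
  have hg : ContinuousOn g (Ioi 0) := fun r hr =>
    (h.hasDerivAt r hr).continuousAt.continuousWithinAt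
  have hA : LocallyIntegrableOn (fun r => r ^ N * deriv f (g r)) (Ioi 0) :=
    (continuousOn_pow_mul N
      ((hf.continuous_deriv le_rfl).comp_continuousOn hg)).locallyIntegrableOn measurableSet_Ioi
  have hB : LocallyIntegrableOn (fun r => r ^ N * (1 / √(1 + p r ^ 2) ^ 3)) (Ioi 0) :=
    (continuousOn_pow_mul N (continuousOn_const.div
      ((continuous_sqrt_one_add_sq.pow 3).comp_continuousOn h.continuousOn)
      fun r _ => pow_ne_zero 3 (sqrt_one_add_sq_pos _).ne')).locallyIntegrableOn measurableSet_Ioi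
  have hI := hη.integrable_mul_hardyDensity
    (continuousOn_pow_mul N (continuous_jacobiWeight.comp_continuousOn h.continuousOn)) N
  have hIA := hq.integrable_mul_sq hA
  have hIB := hq.integrable_mul_deriv_sq one_ne_zero hB
  have hIF : Integrable (deriv fun r => jacobiFlux N f g p r * p r * η r ^ 2) :=
    (hF.contDiff.continuous_deriv le_rfl).integrable_of_hasCompactSupport
      hF.hasCompactSupport.deriv
  have hle := integral_mono (hI.add (hIB.sub hIA)) hIF fun r => ?_
  · rw [integral_add' hI (hIB.sub hIA), integral_sub' hIB hIA,
      hF.integral_deriv_eq_zero one_ne_zero] at hle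
    exact le_of_add_le_of_nonneg_left hle
      (sub_nonneg.mpr (quadratic_le_of_smooth isOpen_Ioi hA hB hst hq))
  · simp only [Pi.add_apply, Pi.sub_apply, Function.comp_apply]
    rcases lt_or_ge 0 r with hr | hr
    · exact h.hardyDensity_add_stabilityForm_le hf (hη.contDiff.differentiable one_ne_zero r) hr
    · have hr' : r ∉ Ioi (0 : ℝ) := not_lt.mpr hr
      simp [hardyDensity, image_eq_zero_of_notMem_tsupport fun hm => hr' (hη.tsupport_subset hm),
        image_eq_zero_of_notMem_tsupport fun hm =>
          hr' (hη.tsupport_subset (tsupport_deriv_subset hm)),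
        image_eq_zero_of_notMem_tsupport fun hm =>
          hr' (hq.tsupport_subset (tsupport_deriv_subset hm)),
        image_eq_zero_of_notMem_tsupport fun hm =>
          hr' (hF.tsupport_subset (tsupport_deriv_subset hm))]

end IsRadialSolution

/-! ### Growth forced by a Hardy inequality -/

theorem hardyDensity_congr {c r : ℝ} {η ζ : ℝ → ℝ} (h : η =ᶠ[𝓝 r] ζ) :
    hardyDensity c η r = hardyDensity c ζ r := by
  rw [hardyDensity, hardyDensity, h.eq_of_nhds, h.deriv_eq]

theorem hardyDensity_eq_div (c : ℝ) (η : ℝ → ℝ) {r : ℝ} (hr : r ≠ 0) :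
    hardyDensity c η r = (c * η r ^ 2 - (r * deriv η r) ^ 2) / r ^ 2 := by
  rw [hardyDensity, mul_pow, sub_div, mul_div_cancel_left₀ _ (pow_ne_zero 2 hr)]

theorem continuousOn_hardyDensity {η : ℝ → ℝ} (hη : ContDiffOn ℝ 1 η (Ioi 0)) (c : ℝ) :
    ContinuousOn (hardyDensity c η) (Ioi 0) :=
  ((continuousOn_const.mul (hη.continuousOn.pow 2)).div (continuous_pow 2).continuousOn
    fun _ hr => pow_ne_zero 2 (ne_of_gt hr)).sub
    ((hη.continuousOn_deriv_of_isOpen isOpen_Ioi le_rfl).pow 2)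

theorem abs_hardyDensity_le {c A r : ℝ} {η : ℝ → ℝ} (hc : 0 ≤ c) (hr : 0 < r)
    (hη : |η r| ≤ A * √r) (hη' : |r * deriv η r| ≤ A * √r) :
    |hardyDensity c η r| ≤ (c + 1) * A ^ 2 / r := by
  have hsq : ∀ {t : ℝ}, |t| ≤ A * √r → t ^ 2 ≤ A ^ 2 * r := fun {t} ht => by
    simpa only [sq_abs, mul_pow, Real.sq_sqrt hr.le] using pow_le_pow_left₀ (abs_nonneg t) ht 2
  rw [hardyDensity_eq_div c η hr.ne', abs_div, abs_of_pos (pow_pos hr 2),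
    div_le_div_iff₀ (pow_pos hr 2) hr]
  have habs : |c * η r ^ 2 - (r * deriv η r) ^ 2| ≤ (c + 1) * (A ^ 2 * r) := by
    rw [abs_le]
    constructor <;> nlinarith [hsq hη, hsq hη', sq_nonneg (η r), sq_nonneg (r * deriv η r),
      mul_nonneg hc (sq_nonneg (η r)), mul_le_mul_of_nonneg_left (hsq hη) hc]
  calc |c * η r ^ 2 - (r * deriv η r) ^ 2| * r ≤ (c + 1) * (A ^ 2 * r) * r := by gcongr
    _ = (c + 1) * A ^ 2 * r ^ 2 := by ring

theorem deriv_smoothTransition_of_notMem_Icc {x : ℝ} (hx : x ∉ Icc (0 : ℝ) 1) :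
    deriv Real.smoothTransition x = 0 := by
  rcases lt_or_ge x 0 with h0 | h0
  · have hmin : IsLocalMin Real.smoothTransition x := Eventually.of_forall fun y => by
      rw [Real.smoothTransition.zero_of_nonpos h0.le]
      exact Real.smoothTransition.nonneg y
    exact hmin.deriv_eq_zero
  · have hmax : IsLocalMax Real.smoothTransition x := Eventually.of_forall fun y => by
      rw [Real.smoothTransition.one_of_one_le (not_le.mp fun h1 => hx ⟨h0, h1⟩).le]
      exact Real.smoothTransition.le_one y
    exact hmax.deriv_eq_zero

/-- A smooth step in the variable `l * r`, from `0` for `l * r ≤ 1` to `1` for `2 ≤ l * r`. -/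
def scaledStep (l r : ℝ) : ℝ := Real.smoothTransition (l * r - 1)

section ScaledStep

variable {l r : ℝ}

theorem contDiff_scaledStep (l : ℝ) : ContDiff ℝ 1 (scaledStep l) :=
  Real.smoothTransition.contDiff.comp ((contDiff_const.mul contDiff_id).sub contDiff_const)

theorem scaledStep_nonneg (l r : ℝ) : 0 ≤ scaledStep l r := Real.smoothTransition.nonneg _

theorem scaledStep_le_one (l r : ℝ) : scaledStep l r ≤ 1 := Real.smoothTransition.le_one _

theorem scaledStep_of_mul_le_one (h : l * r ≤ 1) : scaledStep l r = 0 :=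
  Real.smoothTransition.zero_of_nonpos (sub_nonpos.mpr h)

theorem scaledStep_of_two_le_mul (h : 2 ≤ l * r) : scaledStep l r = 1 :=
  Real.smoothTransition.one_of_one_le (by linarith)

theorem exists_abs_mul_deriv_scaledStep_le :
    ∃ K, ∀ l r, |r * deriv (scaledStep l) r| ≤ K := by
  have hc : Continuous fun x => x * deriv Real.smoothTransition (x - 1) :=
    continuous_id.mul (((Real.smoothTransition.contDiff (n := 1)).continuous_deriv le_rfl).comp
      (continuous_id.sub continuous_const))
  have hK : HasCompactSupport fun x => x * deriv Real.smoothTransition (x - 1) :=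
    HasCompactSupport.intro (isCompact_Icc (a := 1) (b := 2)) fun x hx => by
      rw [deriv_smoothTransition_of_notMem_Icc fun h => hx ⟨by linarith [h.1], by linarith [h.2]⟩,
        mul_zero]
  obtain ⟨K, hK⟩ := hK.exists_bound_of_continuous hc
  refine ⟨K, fun l r => ?_⟩
  have hderiv : HasDerivAt (scaledStep l) (deriv Real.smoothTransition (l * r - 1) * (l * 1)) r :=
    ((Real.smoothTransition.contDiff (n := 1)).differentiable one_ne_zero _).hasDerivAt.comp r
      (((hasDerivAt_id r).const_mul l).sub_const 1)
  rw [hderiv.deriv, mul_one, mul_left_comm, mul_comm r, mul_comm]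
  exact hK (l * r)

theorem isTestOn_mul_scaledStep {η : ℝ → ℝ} {b : ℝ} (hl : 0 < l)
    (hη : ContDiffOn ℝ 1 η (Ioi 0)) (hb : ∀ r, b ≤ r → η r = 0) :
    IsTestOn 1 (Ioi 0) fun r => η r * scaledStep l r := by
  have hsupp : Function.support (fun r => η r * scaledStep l r) ⊆ Icc l⁻¹ b := fun r hr => by
    refine ⟨?_, ?_⟩ <;> by_contra! h
    · refine hr (mul_eq_zero_of_right _ (scaledStep_of_mul_le_one ?_))
      rw [← mul_inv_cancel₀ hl.ne']
      exact mul_le_mul_of_nonneg_left h.le hl.le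
    · exact hr (mul_eq_zero_of_left (hb r h.le) _)
  have htsupp : tsupport (fun r => η r * scaledStep l r) ⊆ Ioi 0 :=
    (closure_minimal hsupp isClosed_Icc).trans fun r hr => (inv_pos.mpr hl).trans_le hr.1
  exact ⟨contDiff_of_contDiffOn_of_tsupport_subset isOpen_Ioi
    (hη.mul (contDiff_scaledStep l).contDiffOn) htsupp,
    HasCompactSupport.of_support_subset_isCompact isCompact_Icc hsupp, htsupp⟩

theorem mul_scaledStep_eventuallyEq (η : ℝ → ℝ) (h : 2 < l * r) :
    (fun r => η r * scaledStep l r) =ᶠ[𝓝 r] η := by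
  filter_upwards [(continuous_const_mul l).continuousAt.eventually_const_lt h] with y hy
  rw [scaledStep_of_two_le_mul hy.le, mul_one]

theorem abs_mul_deriv_mul_le {η χ : ℝ → ℝ} {A B K r : ℝ} (hη : DifferentiableAt ℝ η r)
    (hχ : DifferentiableAt ℝ χ r) (hA : |η r| ≤ A) (hB : |r * deriv η r| ≤ B) (h1 : |χ r| ≤ 1)
    (hK : |r * deriv χ r| ≤ K) : |r * deriv (fun r => η r * χ r) r| ≤ B + A * K := by
  have hderiv : HasDerivAt (fun r => η r * χ r) _ r := hη.hasDerivAt.mul hχ.hasDerivAt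
  calc |r * deriv (fun r => η r * χ r) r|
      = |r * deriv η r * χ r + η r * (r * deriv χ r)| := by rw [hderiv.deriv]; ring_nf
    _ ≤ |r * deriv η r| * |χ r| + |η r| * |r * deriv χ r| := by
        rw [← abs_mul, ← abs_mul]; exact abs_add_le _ _
    _ ≤ B * 1 + A * K := by
        have := (abs_nonneg _).trans hA
        have := (abs_nonneg _).trans hB
        gcongr
    _ = B + A * K := by rw [mul_one]

end ScaledStep

section Origin

variable {w η : ℝ → ℝ} {c A b : ℝ}

theorem abs_mul_hardyDensity_le (hc : 0 ≤ c) {r : ℝ} (hr : 0 < r) (hw : |w r| ≤ r)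
    (hη : |η r| ≤ A * √r) (hη' : |r * deriv η r| ≤ A * √r) :
    |w r * hardyDensity c η r| ≤ (c + 1) * A ^ 2 := by
  calc |w r * hardyDensity c η r| ≤ r * ((c + 1) * A ^ 2 / r) := by
        rw [abs_mul]
        exact mul_le_mul hw (abs_hardyDensity_le hc hr hη hη') (abs_nonneg _) hr.le
    _ = (c + 1) * A ^ 2 := mul_div_cancel₀ _ hr.ne'

theorem integrableOn_mul_hardyDensity (hw : ContinuousOn w (Ioi 0))
    (hw1 : ∀ r ∈ Ioc (0 : ℝ) 1, |w r| ≤ r) (hη : ContDiffOn ℝ 1 η (Ioi 0))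
    (hb : ∀ r, b ≤ r → η r = 0) (hA : ∀ r ∈ Ioc (0 : ℝ) 1, |η r| ≤ A * √r)
    (hA' : ∀ r ∈ Ioc (0 : ℝ) 1, |r * deriv η r| ≤ A * √r) (hc : 0 ≤ c) :
    IntegrableOn (fun r => w r * hardyDensity c η r) (Ioi 0) := by
  rw [← Ioc_union_Ioi_eq_Ioi zero_le_one, integrableOn_union]
  constructor
  · exact Integrable.of_bound
      (((hw.mul (continuousOn_hardyDensity hη c)).mono Ioc_subset_Ioi_self).aestronglyMeasurable
        measurableSet_Ioc) ((c + 1) * A ^ 2)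
      ((ae_restrict_mem measurableSet_Ioc).mono fun r hr =>
        abs_mul_hardyDensity_le hc hr.1 (hw1 r hr) (hA r hr) (hA' r hr))
  · refine ((isTestOn_mul_scaledStep two_pos hη hb).integrable_mul_hardyDensity hw c
      |>.integrableOn).congr_fun (fun r (hr : 1 < r) => ?_) measurableSet_Ioi
    simp only [hardyDensity_congr (mul_scaledStep_eventuallyEq η (by linarith : 2 < 2 * r))]

theorem abs_mul_hardyDensity_mul_scaledStep_le (hw1 : ∀ r ∈ Ioc (0 : ℝ) 1, |w r| ≤ r)
    (hη : ContDiffOn ℝ 1 η (Ioi 0)) (hA : ∀ r ∈ Ioc (0 : ℝ) 1, |η r| ≤ A * √r)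
    (hA' : ∀ r ∈ Ioc (0 : ℝ) 1, |r * deriv η r| ≤ A * √r) (hc : 0 ≤ c) {l K : ℝ} (hl : 2 ≤ l)
    (hK : ∀ r, |r * deriv (scaledStep l) r| ≤ K) {r : ℝ} (hr : 0 < r) :
    |w r * hardyDensity c (fun r => η r * scaledStep l r) r| ≤
      |w r * hardyDensity c η r|
        + (Ioc 0 1).indicator (fun _ => (c + 1) * (A + A * K) ^ 2) r := by
  rcases le_or_gt r 1 with h1 | h1
  · have hr1 : r ∈ Ioc (0 : ℝ) 1 := ⟨hr, h1⟩
    have hηd : DifferentiableAt ℝ η r :=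
      (hη.differentiableOn one_ne_zero).differentiableAt (Ioi_mem_nhds hr)
    have hχ : |scaledStep l r| ≤ 1 := by
      rw [abs_of_nonneg (scaledStep_nonneg l r)]; exact scaledStep_le_one l r
    have hAr : 0 ≤ A * √r := (abs_nonneg _).trans (hA r hr1)
    rw [indicator_of_mem hr1]
    refine (abs_mul_hardyDensity_le hc hr (hw1 r hr1) ?_ ?_).trans
      (le_add_of_nonneg_left (abs_nonneg _))
    · calc |η r * scaledStep l r| ≤ |η r| * 1 := by rw [abs_mul]; gcongr
        _ ≤ A * √r + A * √r * K := by
            rw [mul_one]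
            exact (hA r hr1).trans (le_add_of_nonneg_right
              (mul_nonneg hAr ((abs_nonneg _).trans (hK r))))
        _ = (A + A * K) * √r := by ring
    · refine (abs_mul_deriv_mul_le hηd ((contDiff_scaledStep l).differentiable one_ne_zero r)
        (hA r hr1) (hA' r hr1) hχ (hK r)).trans_eq ?_
      ring
  · rw [hardyDensity_congr (mul_scaledStep_eventuallyEq η (by nlinarith : 2 < l * r))]
    exact le_add_of_nonneg_right (indicator_of_notMem (fun h => h1.not_ge h.2) _).ge

/-- Near the origin a weight `w r ≤ r` gives zero capacity to the point `0`: the Hardy inequality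
extends from functions supported away from `0` to functions of size `O(√r)`. -/
theorem hardy_of_le_sqrt (hw : ContinuousOn w (Ioi 0)) (hw1 : ∀ r ∈ Ioc (0 : ℝ) 1, |w r| ≤ r)
    (hardy : ∀ ζ, IsTestOn 1 (Ioi 0) ζ → ∫ r, w r * hardyDensity c ζ r ≤ 0)
    (hη : ContDiffOn ℝ 1 η (Ioi 0)) (hb : ∀ r, b ≤ r → η r = 0)
    (hA : ∀ r ∈ Ioc (0 : ℝ) 1, |η r| ≤ A * √r)
    (hA' : ∀ r ∈ Ioc (0 : ℝ) 1, |r * deriv η r| ≤ A * √r) (hc : 0 ≤ c) :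
    ∫ r in Ioi 0, w r * hardyDensity c η r ≤ 0 := by
  obtain ⟨K, hK⟩ := exists_abs_mul_deriv_scaledStep_le
  let l : ℕ → ℝ := fun k => k + 2
  have hl : ∀ k, 0 < l k := fun k => by positivity
  let Q : ℕ → ℝ → ℝ := fun k r => η r * scaledStep (l k) r
  have hQ : ∀ k, IsTestOn 1 (Ioi 0) (Q k) := fun k => isTestOn_mul_scaledStep (hl k) hη hb
  have hQint : ∀ k, ∫ r in Ioi 0, w r * hardyDensity c (Q k) r ≤ 0 := fun k => by
    rw [setIntegral_eq_integral_of_forall_compl_eq_zero fun r hr => ?_]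
    · exact hardy _ (hQ k)
    · simp [hardyDensity, image_eq_zero_of_notMem_tsupport fun h => hr ((hQ k).tsupport_subset h),
        image_eq_zero_of_notMem_tsupport fun h =>
          hr ((hQ k).tsupport_subset (tsupport_deriv_subset h))]
  have hF := integrableOn_mul_hardyDensity hw hw1 hη hb hA hA' hc
  have hC : IntegrableOn ((Ioc 0 1).indicator fun _ => (c + 1) * (A + A * K) ^ 2) (Ioi (0 : ℝ)) :=
    ((integrable_indicator_iff measurableSet_Ioc).mpr
      (integrableOn_const measure_Ioc_lt_top.ne)).integrableOn
  refine le_of_tendsto (tendsto_integral_of_dominated_convergence _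
    (fun k => ((hQ k).integrable_mul_hardyDensity hw c).aestronglyMeasurable.restrict)
    (hF.norm.add hC) (fun k => (ae_restrict_mem measurableSet_Ioi).mono fun r hr => ?_)
    ((ae_restrict_mem measurableSet_Ioi).mono fun r (hr : 0 < r) => ?_))
    (Eventually.of_forall hQint)
  · exact abs_mul_hardyDensity_mul_scaledStep_le hw1 hη hA hA' hc
      (le_add_of_nonneg_left k.cast_nonneg) (hK _) hr
  · have hlim : Tendsto (fun k => l k * r) atTop atTop :=
      (tendsto_natCast_atTop_atTop.atTop_add tendsto_const_nhds).atTop_mul_const hr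
    refine tendsto_const_nhds.congr' ((hlim.eventually_gt_atTop 2).mono fun k hk => ?_)
    simp only [Q, hardyDensity_congr (mul_scaledStep_eventuallyEq η hk)]

end Origin

/-- A function of size `√r` near `0` and `r ^ (-s)` near infinity which satisfies the pointwise
inequality `(r h')² < s² h²`. -/
def hardyProfile (s r : ℝ) : ℝ :=
  Real.exp (Real.log r / 2 - (s + 1 / 2) * Real.log (1 + r))

/-- The logarithmic derivative of `hardyProfile s` with respect to `log r`. -/
def hardyExponent (s r : ℝ) : ℝ := 1 / 2 - (s + 1 / 2) * (r / (1 + r))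

/-- `hardyProfile s`, cut off smoothly between `R` and `2 * R`. -/
def truncatedProfile (s R r : ℝ) : ℝ := hardyProfile s r * (1 - scaledStep R⁻¹ r)

section Growth

variable {s r R : ℝ}

theorem hardyProfile_pos (s r : ℝ) : 0 < hardyProfile s r := Real.exp_pos _

theorem hasDerivAt_hardyProfile (s : ℝ) (hr : 0 < r) :
    HasDerivAt (hardyProfile s) (hardyExponent s r * hardyProfile s r / r) r := by
  have hne : 1 + r ≠ 0 := by positivity
  refine (((Real.hasDerivAt_log hr.ne').div_const 2).sub
    ((((hasDerivAt_id r).const_add 1).log hne).const_mul (s + 1 / 2))).exp.congr_deriv ?_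
  simp only [hardyExponent, hardyProfile, Pi.sub_apply, id]
  field_simp

theorem contDiffOn_hardyProfile (s : ℝ) : ContDiffOn ℝ 1 (hardyProfile s) (Ioi 0) := by
  have hexp : ContinuousOn (hardyExponent s) (Ioi 0) :=
    continuousOn_const.sub (continuousOn_const.mul (continuousOn_id.div
      (continuousOn_const.add continuousOn_id) fun r (hr : 0 < r) => (add_pos one_pos hr).ne'))
  refine contDiffOn_one_of_hasDerivAt isOpen_Ioi (fun r hr => hasDerivAt_hardyProfile s hr) ?_
  exact (hexp.mul fun r hr => (hasDerivAt_hardyProfile s hr).continuousAt.continuousWithinAt).div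
    continuousOn_id fun r hr => ne_of_gt hr

theorem abs_hardyExponent_lt (hs : 1 ≤ s) (hr : 0 < r) : |hardyExponent s r| < s := by
  have h0 : 0 < r / (1 + r) := by positivity
  have h1 : r / (1 + r) < 1 := by rw [div_lt_one (by positivity)]; linarith
  rw [hardyExponent, abs_lt]
  constructor <;> nlinarith

theorem mul_deriv_hardyProfile (s : ℝ) (hr : 0 < r) :
    r * deriv (hardyProfile s) r = hardyExponent s r * hardyProfile s r := by
  rw [(hasDerivAt_hardyProfile s hr).deriv, mul_div_cancel₀ _ hr.ne']

theorem abs_mul_deriv_hardyProfile_le (hs : 1 ≤ s) (hr : 0 < r) :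
    |r * deriv (hardyProfile s) r| ≤ s * hardyProfile s r := by
  rw [mul_deriv_hardyProfile s hr, abs_mul, abs_of_pos (hardyProfile_pos s r)]
  exact mul_le_mul_of_nonneg_right (abs_hardyExponent_lt hs hr).le (hardyProfile_pos s r).le

theorem hardyDensity_hardyProfile_pos (hs : 1 ≤ s) (hr : 0 < r) :
    0 < hardyDensity (s ^ 2) (hardyProfile s) r := by
  rw [hardyDensity_eq_div _ _ hr.ne', mul_deriv_hardyProfile s hr, mul_pow, ← sub_mul]
  refine div_pos (mul_pos (sub_pos.mpr ?_) (pow_pos (hardyProfile_pos s r) 2)) (pow_pos hr 2)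
  rw [sq_lt_sq, abs_of_pos (one_pos.trans_le hs)]
  exact abs_hardyExponent_lt hs hr

theorem hardyProfile_le_sqrt (hs : 0 ≤ s) (hr : 0 < r) : hardyProfile s r ≤ √r := by
  rw [← Real.exp_log (Real.sqrt_pos.mpr hr), Real.log_sqrt hr.le, hardyProfile, Real.exp_le_exp]
  exact sub_le_self _ (mul_nonneg (by positivity) (Real.log_nonneg (by linarith)))

theorem hardyProfile_le_rpow (hs : 0 ≤ s) (hr : 0 < r) : hardyProfile s r ≤ r ^ (-s) := by
  rw [Real.rpow_def_of_pos hr, hardyProfile, Real.exp_le_exp]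
  nlinarith [Real.log_le_log hr (by linarith : r ≤ 1 + r)]

theorem contDiffOn_truncatedProfile (s R : ℝ) : ContDiffOn ℝ 1 (truncatedProfile s R) (Ioi 0) :=
  (contDiffOn_hardyProfile s).mul (contDiff_const.sub (contDiff_scaledStep R⁻¹)).contDiffOn

theorem truncatedProfile_of_two_mul_le (hR : 0 < R) (hr : 2 * R ≤ r) :
    truncatedProfile s R r = 0 := by
  rw [truncatedProfile, scaledStep_of_two_le_mul, sub_self, mul_zero]
  rwa [inv_mul_eq_div, le_div_iff₀ hR]

theorem truncatedProfile_eventuallyEq (s : ℝ) (hR : 0 < R) (hr : r < R) :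
    truncatedProfile s R =ᶠ[𝓝 r] hardyProfile s := by
  filter_upwards [Iio_mem_nhds hr] with y (hy : y < R)
  rw [truncatedProfile, scaledStep_of_mul_le_one, sub_zero, mul_one]
  rw [inv_mul_le_one₀ hR]
  exact hy.le

theorem abs_truncatedProfile_le_sqrt (hs : 1 ≤ s) (hR : 1 < R) (hr : r ∈ Ioc (0 : ℝ) 1) :
    |truncatedProfile s R r| ≤ s * √r := by
  rw [(truncatedProfile_eventuallyEq s (one_pos.trans hR) (hr.2.trans_lt hR)).eq_of_nhds,
    abs_of_pos (hardyProfile_pos s r)]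
  exact (hardyProfile_le_sqrt (zero_le_one.trans hs) hr.1).trans
    (le_mul_of_one_le_left (Real.sqrt_nonneg r) hs)

theorem abs_mul_deriv_truncatedProfile_le_sqrt (hs : 1 ≤ s) (hR : 1 < R)
    (hr : r ∈ Ioc (0 : ℝ) 1) : |r * deriv (truncatedProfile s R) r| ≤ s * √r := by
  rw [(truncatedProfile_eventuallyEq s (one_pos.trans hR) (hr.2.trans_lt hR)).deriv_eq]
  exact (abs_mul_deriv_hardyProfile_le hs hr.1).trans (mul_le_mul_of_nonneg_left
    (hardyProfile_le_sqrt (zero_le_one.trans hs) hr.1) (zero_le_one.trans hs))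

theorem abs_deriv_truncatedProfile_le {K : ℝ} (hs : 1 ≤ s) (hR : 0 < R) (hr : R ≤ r)
    (hK : ∀ l r, |r * deriv (scaledStep l) r| ≤ K) :
    |deriv (truncatedProfile s R) r| ≤ (s + K) * R ^ (-s) * R⁻¹ := by
  have hr0 : 0 < r := hR.trans_le hr
  have hsK : 0 ≤ s + K := add_nonneg (zero_le_one.trans hs) ((abs_nonneg _).trans (hK 0 0))
  have hstep : HasDerivAt (fun r => 1 - scaledStep R⁻¹ r) (-deriv (scaledStep R⁻¹) r) r :=
    ((contDiff_scaledStep R⁻¹).differentiable one_ne_zero r).hasDerivAt.const_sub 1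
  have hprod : |r * deriv (truncatedProfile s R) r| ≤
      s * hardyProfile s r + hardyProfile s r * K := by
    refine abs_mul_deriv_mul_le (hasDerivAt_hardyProfile s hr0).differentiableAt
      hstep.differentiableAt (abs_of_pos (hardyProfile_pos s r)).le
      (abs_mul_deriv_hardyProfile_le hs hr0) ?_ ?_
    · rw [abs_of_nonneg (sub_nonneg.mpr (scaledStep_le_one _ _))]
      exact sub_le_self _ (scaledStep_nonneg _ _)
    · rw [hstep.deriv, mul_neg, abs_neg]
      exact hK _ _
  rw [← div_eq_mul_inv, le_div_iff₀ hR]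
  calc |deriv (truncatedProfile s R) r| * R ≤ |r * deriv (truncatedProfile s R) r| := by
        rw [abs_mul, abs_of_pos hr0, mul_comm]; gcongr
    _ ≤ (s + K) * hardyProfile s r := hprod.trans_eq (by ring)
    _ ≤ (s + K) * R ^ (-s) := by
        gcongr
        exact (hardyProfile_le_rpow (zero_le_one.trans hs) hr0).trans
          (Real.rpow_le_rpow_of_nonpos hR hr (neg_nonpos.mpr (zero_le_one.trans hs)))

theorem neg_le_hardyDensity_truncatedProfile {K : ℝ} (hs : 1 ≤ s) (hR : 0 < R) (hr : R ≤ r)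
    (hK : ∀ l r, |r * deriv (scaledStep l) r| ≤ K) :
    -((s + K) ^ 2 * (R ^ (2 * s + 2))⁻¹) ≤ hardyDensity (s ^ 2) (truncatedProfile s R) r := by
  calc -((s + K) ^ 2 * (R ^ (2 * s + 2))⁻¹) = -((s + K) * R ^ (-s) * R⁻¹) ^ 2 := by
        rw [Real.rpow_add hR, Real.rpow_neg hR.le, mul_comm 2 s, Real.rpow_mul hR.le,
          Real.rpow_two, Real.rpow_two]
        field_simp
    _ ≤ -deriv (truncatedProfile s R) r ^ 2 := by
        rw [neg_le_neg_iff, ← sq_abs]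
        exact pow_le_pow_left₀ (abs_nonneg _) (abs_deriv_truncatedProfile_le hs hR hr hK) 2
    _ ≤ hardyDensity (s ^ 2) (truncatedProfile s R) r := by
        rw [hardyDensity, neg_le_sub_iff_le_add]
        exact le_add_of_nonneg_left (by positivity)

theorem neg_le_setIntegral_hardyDensity_truncatedProfile {K : ℝ} {w : ℝ → ℝ} (hs : 1 ≤ s)
    (hR : 0 < R) (hw : ContinuousOn w (Ioi 0)) (hw0 : ∀ r ∈ Ioi (0 : ℝ), 0 ≤ w r)
    (hK : ∀ l r, |r * deriv (scaledStep l) r| ≤ K)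
    (hint : IntegrableOn (fun r => w r * hardyDensity (s ^ 2) (truncatedProfile s R) r) (Ici R)) :
    -((s + K) ^ 2 * (R ^ (2 * s + 2))⁻¹ * ∫ r in Icc R (2 * R), w r) ≤
      ∫ r in Ici R, w r * hardyDensity (s ^ 2) (truncatedProfile s R) r := by
  have hpos : Icc R (2 * R) ⊆ Ioi 0 := fun r hr => hR.trans_le hr.1
  have hvanish : ∀ r ∈ Ici R \ Icc R (2 * R),
      w r * hardyDensity (s ^ 2) (truncatedProfile s R) r = 0 := fun r hr => by
    have hzero : truncatedProfile s R =ᶠ[𝓝 r] fun _ => 0 := by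
      filter_upwards [Ioi_mem_nhds (not_le.mp fun h => hr.2 ⟨hr.1, h⟩)] with y hy
      exact truncatedProfile_of_two_mul_le hR (le_of_lt hy)
    rw [hardyDensity_congr hzero]
    simp [hardyDensity]
  calc -((s + K) ^ 2 * (R ^ (2 * s + 2))⁻¹ * ∫ r in Icc R (2 * R), w r)
      = ∫ r in Icc R (2 * R), -((s + K) ^ 2 * (R ^ (2 * s + 2))⁻¹) * w r := by
        rw [integral_const_mul, neg_mul]
    _ ≤ ∫ r in Icc R (2 * R), w r * hardyDensity (s ^ 2) (truncatedProfile s R) r := by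
        refine setIntegral_mono_on
          ((hw.mono hpos).integrableOn_compact isCompact_Icc |>.const_mul _)
          (hint.mono_set Icc_subset_Ici_self) measurableSet_Icc fun r hr => ?_
        rw [mul_comm]
        exact mul_le_mul_of_nonneg_left (neg_le_hardyDensity_truncatedProfile hs hR hr.1 hK)
          (hw0 r (hpos hr))
    _ = ∫ r in Ici R, w r * hardyDensity (s ^ 2) (truncatedProfile s R) r :=
        (setIntegral_eq_of_subset_of_forall_sdiff_eq_zero measurableSet_Ici Icc_subset_Ici_self
          hvanish).symm

theorem exists_setIntegral_hardyProfile_le (hs : 1 ≤ s) {w : ℝ → ℝ} (hw : ContinuousOn w (Ioi 0))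
    (hw0 : ∀ r ∈ Ioi (0 : ℝ), 0 ≤ w r) (hw1 : ∀ r ∈ Ioc (0 : ℝ) 1, w r ≤ r)
    (hardy : ∀ η, IsTestOn 1 (Ioi 0) η → ∫ r, w r * hardyDensity (s ^ 2) η r ≤ 0) :
    ∃ L, 0 < L ∧ ∀ R, 1 < R →
      IntegrableOn (fun r => w r * hardyDensity (s ^ 2) (hardyProfile s) r) (Ioo 0 R) ∧
      ∫ r in Ioo 0 R, w r * hardyDensity (s ^ 2) (hardyProfile s) r ≤
        L * (R ^ (2 * s + 2))⁻¹ * ∫ r in Icc R (2 * R), w r := by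
  obtain ⟨K, hK⟩ := exists_abs_mul_deriv_scaledStep_le
  have hK0 : 0 ≤ K := (abs_nonneg _).trans (hK 0 0)
  refine ⟨(s + K) ^ 2, by positivity, fun R hR => ?_⟩
  have hR0 : 0 < R := one_pos.trans hR
  have hw1' : ∀ r ∈ Ioc (0 : ℝ) 1, |w r| ≤ r := fun r hr => by
    rw [abs_of_nonneg (hw0 r hr.1)]; exact hw1 r hr
  have hzero : ∀ r, 2 * R ≤ r → truncatedProfile s R r = 0 := fun r =>
    truncatedProfile_of_two_mul_le hR0
  have hint := integrableOn_mul_hardyDensity hw hw1' (contDiffOn_truncatedProfile s R) hzero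
    (fun r => abs_truncatedProfile_le_sqrt hs hR)
    (fun r => abs_mul_deriv_truncatedProfile_le_sqrt hs hR) (sq_nonneg s)
  have hle := hardy_of_le_sqrt hw hw1' hardy (contDiffOn_truncatedProfile s R) hzero
    (fun r => abs_truncatedProfile_le_sqrt hs hR)
    (fun r => abs_mul_deriv_truncatedProfile_le_sqrt hs hR) (sq_nonneg s)
  have hinner : EqOn (fun r => w r * hardyDensity (s ^ 2) (truncatedProfile s R) r)
      (fun r => w r * hardyDensity (s ^ 2) (hardyProfile s) r) (Ioo 0 R) := fun r hr => by
    simp only [hardyDensity_congr (truncatedProfile_eventuallyEq s hR0 hr.2)]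
  rw [← Ioo_union_Ici_eq_Ioi hR0] at hint hle
  have hIoo := hint.left_of_union
  have houter := neg_le_setIntegral_hardyDensity_truncatedProfile hs hR0 hw hw0 hK
    hint.right_of_union
  refine ⟨hIoo.congr_fun hinner measurableSet_Ioo, ?_⟩
  rw [setIntegral_union (Set.disjoint_left.mpr fun r hr hr' => hr.2.not_ge hr') measurableSet_Ici
    hIoo hint.right_of_union, setIntegral_congr_fun measurableSet_Ioo hinner] at hle
  linarith

theorem exists_growth_of_hardy (hs : 1 ≤ s) {w : ℝ → ℝ} (hw : ContinuousOn w (Ioi 0))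
    (hw0 : ∀ r ∈ Ioi (0 : ℝ), 0 ≤ w r) (hw1 : ∀ r ∈ Ioc (0 : ℝ) 1, w r ≤ r)
    (hardy : ∀ η, IsTestOn 1 (Ioi 0) η → ∫ r, w r * hardyDensity (s ^ 2) η r ≤ 0)
    {r₁ : ℝ} (hr₁ : 0 < r₁) (hwr₁ : 0 < w r₁) :
    ∃ c : ℝ, 0 < c ∧ ∃ R₀ : ℝ, 2 < R₀ ∧ ∀ R : ℝ, R₀ ≤ R →
      c * R ^ (2 * s + 2) ≤ ∫ r in Icc R (2 * R), w r := by
  obtain ⟨L, hL, hbound⟩ := exists_setIntegral_hardyProfile_le hs hw hw0 hw1 hardy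
  let k : ℝ → ℝ := fun r => w r * hardyDensity (s ^ 2) (hardyProfile s) r
  let R₀ := max 3 (r₁ + 1)
  have hR₀ : 2 < R₀ := lt_of_lt_of_le (by norm_num) (le_max_left _ _)
  have hkc : ContinuousOn k (Ioi 0) :=
    hw.mul (continuousOn_hardyDensity (contDiffOn_hardyProfile s) (s ^ 2))
  have hk0 : ∀ r, 0 < r → 0 ≤ k r := fun r hr =>
    mul_nonneg (hw0 r hr) (hardyDensity_hardyProfile_pos hs hr).le
  have hsupp : Function.support k ∩ Ioo 0 R₀ ∈ 𝓝 r₁ := by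
    refine inter_mem ((hkc.continuousAt (Ioi_mem_nhds hr₁)).eventually_ne
      (mul_pos hwr₁ (hardyDensity_hardyProfile_pos hs hr₁)).ne')
      (Ioo_mem_nhds hr₁ ((lt_add_one r₁).trans_le (le_max_right _ _)))
  have hpos : 0 < ∫ r in Ioo 0 R₀, k r :=
    (setIntegral_pos_iff_support_of_nonneg_ae
      ((ae_restrict_mem measurableSet_Ioo).mono fun r hr => hk0 r hr.1)
      (hbound R₀ (by linarith)).1).mpr (Measure.measure_pos_of_mem_nhds volume hsupp)
  refine ⟨(∫ r in Ioo 0 R₀, k r) / L, div_pos hpos hL, R₀, hR₀, fun R hR => ?_⟩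
  have hR0 : 0 < R ^ (2 * s + 2) := Real.rpow_pos_of_pos (by linarith) _
  obtain ⟨hint, hle⟩ := hbound R (by linarith)
  have hmono : ∫ r in Ioo 0 R₀, k r ≤ ∫ r in Ioo 0 R, k r :=
    setIntegral_mono_set hint ((ae_restrict_mem measurableSet_Ioo).mono fun r hr => hk0 r hr.1)
      (Ioo_subset_Ioo_right hR).eventuallyLE
  rw [div_mul_eq_mul_div, div_le_iff₀ hL, ← le_div_iff₀ hR0]
  exact (hmono.trans hle).trans_eq (by ring)

end Growth

/-! ### Polar coordinates -/

theorem isCompact_preimage_norm {E : Type*} [NormedAddCommGroup E] [ProperSpace E] {K : Set ℝ}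
    (hK : IsCompact K) :
    IsCompact (norm ⁻¹' K : Set E) := by
  obtain ⟨M, hM⟩ := hK.bddAbove
  refine (isCompact_closedBall (0 : E) M).of_isClosed_subset
    (hK.isClosed.preimage continuous_norm) fun x hx => ?_
  rw [mem_closedBall_zero_iff]
  exact hM hx

section Polar

variable {E : Type*} [NormedAddCommGroup E] [NormedSpace ℝ E]

theorem norm_smul_sphere (θ : Metric.sphere (0 : E) 1) {r : ℝ} (hr : 0 ≤ r) :
    ‖r • (θ : E)‖ = r := by
  rw [norm_smul, norm_eq_of_mem_sphere, mul_one, Real.norm_of_nonneg hr]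

theorem homeomorphUnitSphereProd_comp (F : E → ℝ) :
    (fun z : Metric.sphere (0 : E) 1 × Ioi (0 : ℝ) => F (z.2.1 • (z.1 : E))) ∘
      homeomorphUnitSphereProd E = F ∘ Subtype.val := by
  ext x
  simp only [Function.comp_apply, ← homeomorphUnitSphereProd_symm_apply_coe,
    Homeomorph.symm_apply_apply]

variable [FiniteDimensional ℝ E] [MeasurableSpace E] [BorelSpace E]

/-- The integral of `h` over the sphere of radius `r`, with respect to the surface measure of the
unit sphere: the surface area element `r ^ (dim E - 1)` is not included. -/
def sphereIntegral (μ : Measure E) (h : E → ℝ) (r : ℝ) : ℝ :=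
  ∫ θ : Metric.sphere (0 : E) 1, h (r • (θ : E)) ∂μ.toSphere

theorem integral_volumeIoiPow (N : ℕ) (F : ℝ → ℝ) :
    ∫ r : Ioi (0 : ℝ), F r ∂Measure.volumeIoiPow N = ∫ r in Ioi (0 : ℝ), r ^ N * F r := by
  simp only [Measure.volumeIoiPow, ENNReal.ofReal]
  rw [integral_withDensity_eq_integral_smul,
    integral_subtype_comap measurableSet_Ioi fun a ↦ Real.toNNReal (a ^ N) • F a]
  · refine setIntegral_congr_fun measurableSet_Ioi fun r hr ↦ ?_
    simp only [NNReal.smul_def, Real.coe_toNNReal _ (pow_nonneg (le_of_lt hr) N), smul_eq_mul]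
  · exact (measurable_subtype_coe.pow_const _).real_toNNReal

theorem integrable_volumeIoiPow_iff (N : ℕ) (F : ℝ → ℝ) :
    Integrable (fun r : Ioi (0 : ℝ) => F r) (Measure.volumeIoiPow N) ↔
      IntegrableOn (fun r => r ^ N * F r) (Ioi 0) := by
  rw [integrableOn_iff_comap_subtypeVal measurableSet_Ioi, Measure.volumeIoiPow,
    integrable_withDensity_iff_integrable_smul' (by fun_prop) (by simp)]
  refine integrable_congr (.of_forall ?_)
  rintro ⟨r, hr : 0 < r⟩
  simp (disch := positivity) [ENNReal.toReal_ofReal]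

theorem ae_volumeIoiPow_iff (N : ℕ) {P : ℝ → Prop} :
    (∀ᵐ r : Ioi (0 : ℝ) ∂Measure.volumeIoiPow N, P r) ↔ ∀ᵐ r, r ∈ Ioi (0 : ℝ) → P r := by
  rw [← ae_restrict_iff' measurableSet_Ioi, ae_restrict_iff_subtype measurableSet_Ioi,
    Measure.volumeIoiPow, ae_withDensity_iff (by fun_prop)]
  refine eventually_congr (.of_forall fun r => ?_)
  have hne : ENNReal.ofReal (r.1 ^ N) ≠ 0 := by simpa using pow_pos r.2 N
  simp [hne]

variable (μ : Measure E) [μ.IsAddHaarMeasure] {F h : E → ℝ}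

theorem integrable_prod_sphere (hF : Integrable F μ) :
    Integrable (fun z : Metric.sphere (0 : E) 1 × Ioi (0 : ℝ) => F (z.2.1 • (z.1 : E)))
      (μ.toSphere.prod (.volumeIoiPow (Module.finrank ℝ E - 1))) := by
  rw [← μ.measurePreserving_homeomorphUnitSphereProd.integrable_comp_emb
    (homeomorphUnitSphereProd E).measurableEmbedding, homeomorphUnitSphereProd_comp F,
    ← integrableOn_iff_comap_subtypeVal (measurableSet_singleton _).compl]
  exact hF.integrableOn

theorem integrableOn_pow_mul_sphereIntegral (hF : Integrable F μ) :
    IntegrableOn (fun r => r ^ (Module.finrank ℝ E - 1) * sphereIntegral μ F r) (Ioi 0) :=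
  (integrable_volumeIoiPow_iff _ _).mp (integrable_prod_sphere μ hF).integral_prod_right

theorem locallyIntegrableOn_sphereIntegral (hh : LocallyIntegrable h μ) :
    LocallyIntegrableOn (sphereIntegral μ h) (Ioi 0) := by
  rw [locallyIntegrableOn_iff isOpen_Ioi.isLocallyClosed]
  intro K hK hKc
  have hcpt : IsCompact (norm ⁻¹' K : Set E) := isCompact_preimage_norm hKc
  have hpow := (integrableOn_pow_mul_sphereIntegral μ
    ((integrable_indicator_iff hcpt.measurableSet).mpr
      (hh.integrableOn_isCompact hcpt))).mono_set hK
  refine (hpow.continuousOn_mul (g := fun r => (r ^ (Module.finrank ℝ E - 1))⁻¹)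
    ((continuous_pow _).continuousOn.inv₀ fun r hr => pow_ne_zero _ (ne_of_gt (hK hr)))
    hKc).congr_fun (fun r hr => ?_) hKc.measurableSet
  have hr0 : 0 < r := hK hr
  have hind : sphereIntegral μ ((norm ⁻¹' K).indicator h) r = sphereIntegral μ h r :=
    integral_congr_ae (.of_forall fun θ => indicator_of_mem
      (show r • (θ : E) ∈ norm ⁻¹' K by rwa [mem_preimage, norm_smul_sphere θ hr0.le]) h)
  simp only [hind, inv_mul_cancel_left₀ (pow_ne_zero _ hr0.ne')]

theorem ae_norm_of_ae {P : ℝ → Prop} (h : ∀ᵐ r, r ∈ Ioi (0 : ℝ) → P r) [Nontrivial E] :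
    ∀ᵐ x ∂μ, P ‖x‖ := by
  have hprod : ∀ᵐ z ∂μ.toSphere.prod (.volumeIoiPow (Module.finrank ℝ E - 1)), P z.2.1 :=
    Measure.quasiMeasurePreserving_snd.ae ((ae_volumeIoiPow_iff _).mpr h)
  rw [← restrict_compl_singleton (μ := μ) 0,
    ae_restrict_iff_subtype (measurableSet_singleton _).compl]
  simpa using μ.measurePreserving_homeomorphUnitSphereProd.quasiMeasurePreserving.ae hprod

theorem ae_ae_sphere_of_ae {P : E → Prop} (h : ∀ᵐ x ∂μ, P x) [Nontrivial E] :
    ∀ᵐ r, r ∈ Ioi (0 : ℝ) → ∀ᵐ θ : Metric.sphere (0 : E) 1 ∂μ.toSphere, P (r • (θ : E)) := by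
  have hsub : ∀ᵐ x : ({0}ᶜ : Set E) ∂(μ.comap Subtype.val), P x := by
    rwa [← ae_restrict_iff_subtype (measurableSet_singleton _).compl, restrict_compl_singleton]
  have hprod : ∀ᵐ z ∂μ.toSphere.prod (.volumeIoiPow (Module.finrank ℝ E - 1)),
      P (z.2.1 • (z.1 : E)) := by
    simp only [← homeomorphUnitSphereProd_symm_apply_coe]
    exact (MeasurePreserving.symm (homeomorphUnitSphereProd E).toMeasurableEquiv
        μ.measurePreserving_homeomorphUnitSphereProd).quasiMeasurePreserving.ae hsub
  exact (ae_volumeIoiPow_iff (Module.finrank ℝ E - 1)).mp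
    (Measure.ae_ae_of_ae_prod (Measure.measurePreserving_swap.quasiMeasurePreserving.ae hprod))

variable [Nontrivial E]

theorem integral_eq_integral_pow_mul_sphereIntegral (hF : Integrable F μ) :
    ∫ x, F x ∂μ = ∫ r in Ioi (0 : ℝ), r ^ (Module.finrank ℝ E - 1) * sphereIntegral μ F r := by
  calc ∫ x, F x ∂μ = ∫ x : ({0}ᶜ : Set E), F x ∂(μ.comap Subtype.val) := by
        rw [integral_subtype_comap (measurableSet_singleton _).compl, restrict_compl_singleton]
    _ = ∫ z, F (z.2.1 • (z.1 : E))
          ∂(μ.toSphere.prod (.volumeIoiPow (Module.finrank ℝ E - 1))) := by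
        rw [← μ.measurePreserving_homeomorphUnitSphereProd.integral_comp
          (homeomorphUnitSphereProd E).measurableEmbedding]
        exact congrArg (integral _) (homeomorphUnitSphereProd_comp F).symm
    _ = ∫ r in Ioi (0 : ℝ), r ^ (Module.finrank ℝ E - 1) * sphereIntegral μ F r := by
        rw [integral_prod_symm _ (integrable_prod_sphere μ hF), ← integral_volumeIoiPow]
        rfl

theorem integral_mul_comp_norm (hh : LocallyIntegrable h μ) {φ : ℝ → ℝ} (hφ : Continuous φ)
    (hc : HasCompactSupport φ) (hs : tsupport φ ⊆ Ioi 0) :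
    ∫ x, h x * φ ‖x‖ ∂μ = ∫ r, r ^ (Module.finrank ℝ E - 1) * sphereIntegral μ h r * φ r := by
  have hcE : HasCompactSupport fun x : E => φ ‖x‖ :=
    (isCompact_preimage_norm hc).of_isClosed_subset (isClosed_tsupport _)
      (tsupport_comp_subset_preimage φ continuous_norm)
  have hint : Integrable (fun x => h x * φ ‖x‖) μ :=
    hh.integrable_smul_right_of_hasCompactSupport (hφ.comp continuous_norm) hcE
  rw [integral_eq_integral_pow_mul_sphereIntegral μ hint]
  refine Eq.trans ?_ (setIntegral_eq_integral_of_forall_compl_eq_zero (s := Ioi 0) fun r hr => by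
    rw [image_eq_zero_of_notMem_tsupport fun hr' => hr (hs hr'), mul_zero])
  refine setIntegral_congr_fun measurableSet_Ioi fun r (hr : 0 < r) => ?_
  simp only [sphereIntegral, norm_smul_sphere _ hr.le, integral_mul_const, mul_assoc]

theorem toSphere_real_univ_pos : 0 < μ.toSphere.real univ :=
  ENNReal.toReal_pos (Measure.measure_univ_ne_zero.mpr (Measure.toSphere_ne_zero μ))
    (measure_ne_top _ _)

theorem ae_eq_sphereIntegral_of_radial {g : ℝ → ℝ} (hg : ∀ᵐ x ∂μ, h x = g ‖x‖) :
    ∀ᵐ x ∂μ, h x = (μ.toSphere.real univ)⁻¹ * sphereIntegral μ h ‖x‖ := by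
  have hprofile : ∀ᵐ r, r ∈ Ioi (0 : ℝ) →
      g r = (μ.toSphere.real univ)⁻¹ * sphereIntegral μ h r := by
    filter_upwards [ae_ae_sphere_of_ae μ hg] with r hr hr0
    have hconst : sphereIntegral μ h r = ∫ _ : Metric.sphere (0 : E) 1, g r ∂μ.toSphere := by
      refine integral_congr_ae ?_
      filter_upwards [hr hr0] with θ hθ
      rw [hθ, norm_smul_sphere θ (le_of_lt hr0)]
    rw [hconst, integral_const, smul_eq_mul, inv_mul_cancel_left₀ (toSphere_real_univ_pos μ).ne']
  filter_upwards [hg, ae_norm_of_ae μ hprofile] with x hx hx'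
  rw [hx, hx']

theorem integral_comp_norm {F : ℝ → ℝ} (hF : ∀ r ∉ Ioi 0, F r = 0) :
    ∫ x, F ‖x‖ ∂μ = μ.toSphere.real univ * ∫ r, r ^ (Module.finrank ℝ E - 1) * F r := by
  rw [integral_fun_norm_addHaar, Measure.toSphere_real_apply_univ, nsmul_eq_mul, smul_eq_mul,
    ← mul_assoc]
  simp only [smul_eq_mul]
  rw [setIntegral_eq_integral_of_forall_compl_eq_zero fun r hr => by rw [hF r hr, mul_zero]]

theorem setIntegral_comp_norm {S : Set ℝ} (hS : MeasurableSet S) (hS0 : S ⊆ Ioi 0) (F : ℝ → ℝ) :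
    ∫ x in norm ⁻¹' S, F ‖x‖ ∂μ =
      μ.toSphere.real univ * ∫ r in S, r ^ (Module.finrank ℝ E - 1) * F r := by
  rw [← integral_indicator (measurable_norm hS), ← integral_indicator hS]
  simp only [indicator_mul_right]
  exact integral_comp_norm μ fun r hr => indicator_of_notMem (fun hr' => hr (hS0 hr')) F

theorem measureReal_annulus {R : ℝ} (hR : 0 < R) :
    μ.real (Metric.ball 0 (2 * R) \ Metric.ball 0 R) =
      (2 ^ Module.finrank ℝ E - 1) * R ^ Module.finrank ℝ E * μ.real (Metric.ball 0 1) := by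
  rw [measureReal_sdiff (Metric.ball_subset_ball (by linarith)) measurableSet_ball,
    ← Measure.addHaar_real_closedBall_eq_addHaar_real_ball,
    ← Measure.addHaar_real_closedBall_eq_addHaar_real_ball,
    Measure.addHaar_real_closedBall μ _ (by positivity), Measure.addHaar_real_closedBall μ _ hR.le]
  ring

theorem setAverage_annulus_comp_norm {R : ℝ} (hR : 0 < R) (F : ℝ → ℝ) :
    ⨍ x in Metric.ball 0 (2 * R) \ Metric.ball 0 R, F ‖x‖ ∂μ =
      Module.finrank ℝ E / (2 ^ Module.finrank ℝ E - 1) / R ^ Module.finrank ℝ E *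
        ∫ r in Icc R (2 * R), r ^ (Module.finrank ℝ E - 1) * F r := by
  have hann : Metric.ball (0 : E) (2 * R) \ Metric.ball 0 R = norm ⁻¹' Ico R (2 * R) := by
    ext x
    simp [and_comm]
  have hball : μ.real (Metric.ball (0 : E) 1) ≠ 0 :=
    (ENNReal.toReal_pos (Metric.measure_ball_pos μ _ one_pos).ne' measure_ball_lt_top.ne).ne'
  rw [setAverage_eq, measureReal_annulus μ hR, hann, setIntegral_comp_norm μ measurableSet_Ico
    fun r hr => hR.trans_le hr.1, Measure.toSphere_real_apply_univ, integral_Icc_eq_integral_Ico,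
    smul_eq_mul]
  field_simp

end Polar

section CompNorm

variable {E : Type*} [NormedAddCommGroup E] [InnerProductSpace ℝ E]

theorem hasGradientAt_comp_norm [CompleteSpace E] {φ : ℝ → ℝ} {φ' : ℝ} {x : E} (hx : x ≠ 0)
    (hφ : HasDerivAt φ φ' ‖x‖) :
    HasGradientAt (fun y : E => φ ‖y‖) ((φ' * ‖x‖⁻¹) • x) x := by
  have hnorm : HasFDerivAt (fun y : E => √(‖y‖ ^ 2)) _ x :=
    (hasStrictFDerivAt_norm_sq x).hasFDerivAt.sqrt (pow_ne_zero 2 (norm_ne_zero_iff.mpr hx))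
  simp only [Real.sqrt_sq (norm_nonneg _)] at hnorm
  rw [hasGradientAt_iff_hasFDerivAt]
  refine (hφ.comp_hasFDerivAt x hnorm).congr_fderiv ?_
  ext v
  simp
  ring

theorem IsTestOn.comp_norm [FiniteDimensional ℝ E] {k : WithTop ℕ∞} {φ : ℝ → ℝ}
    (hφ : IsTestOn k (Ioi 0) φ) : IsTestOn k ({0}ᶜ : Set E) (fun y => φ ‖y‖) := by
  have hpre : tsupport (fun y : E => φ ‖y‖) ⊆ norm ⁻¹' tsupport φ :=
    tsupport_comp_subset_preimage φ continuous_norm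
  have hs : tsupport (fun y : E => φ ‖y‖) ⊆ {0}ᶜ := fun y hy =>
    norm_pos_iff.mp (hφ.tsupport_subset (hpre hy))
  exact ⟨contDiff_of_contDiffOn_of_tsupport_subset isOpen_compl_singleton
    (hφ.contDiff.comp_contDiffOn fun y hy => (contDiffAt_norm ℝ hy).contDiffWithinAt) hs,
    (isCompact_preimage_norm hφ.hasCompactSupport).of_isClosed_subset (isClosed_tsupport _) hpre,
    hs⟩

theorem norm_radial_smul {x : E} (hx : x ≠ 0) (t : ℝ) : ‖(t * ‖x‖⁻¹) • x‖ = |t| := by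
  rw [norm_smul, norm_mul, norm_inv, norm_norm, Real.norm_eq_abs,
    inv_mul_cancel_right₀ (norm_ne_zero_iff.mpr hx)]

theorem inner_radial_smul {x : E} (hx : x ≠ 0) (s t : ℝ) :
    inner ℝ ((s * ‖x‖⁻¹) • x) ((t * ‖x‖⁻¹) • x) = s * t := by
  have hx' : ‖x‖ ≠ 0 := norm_ne_zero_iff.mpr hx
  rw [real_inner_smul_left, real_inner_smul_right, real_inner_self_eq_norm_sq]
  field_simp

end CompNorm

/-! ### Radial Sobolev functions -/

section Sobolev

variable {n : ℕ}

local notation "𝔼" => EuclideanSpace ℝ (Fin n)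

theorem MemSobolevLoc.locallyIntegrable {k : ℕ} {u : 𝔼 → ℝ} (hu : MemSobolevLoc k u) :
    LocallyIntegrable u volume := by
  cases k with
  | zero => exact hu
  | succ k => exact hu.1

theorem MemSobolevLoc.exists_isWeakGradient {k : ℕ} {u : 𝔼 → ℝ} (hu : MemSobolevLoc (k + 1) u) :
    ∃ G : 𝔼 → 𝔼, IsWeakGradient u G ∧ ∀ i, MemSobolevLoc k fun x => G x i := by
  choose v hv hvk using hu.2
  refine ⟨fun x => WithLp.toLp 2 fun i => v i x, ⟨hu.1, ?_, hv⟩, hvk⟩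
  have hsum : (fun x => WithLp.toLp 2 fun i => v i x) =
      fun x => ∑ i, v i x • EuclideanSpace.single i (1 : ℝ) := by
    ext x j
    simp [Pi.single_apply]
  rw [hsum]
  exact locallyIntegrable_finsetSum _ fun i _ => fun x =>
    ((hvk i).locallyIntegrable x).imp fun _ hs => ⟨hs.1, hs.2.smul_const _⟩

theorem IsWeakGradient.locallyIntegrable_apply {u : 𝔼 → ℝ} {G : 𝔼 → 𝔼}
    (hG : IsWeakGradient u G) (i : Fin n) : LocallyIntegrable fun x => G x i :=
  hG.locallyIntegrable_grad.mono
    ((EuclideanSpace.proj (𝕜 := ℝ) i).continuous.comp_aestronglyMeasurable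
      hG.locallyIntegrable_grad.aestronglyMeasurable)
    (.of_forall fun x => PiLp.norm_apply_le (G x) i)

theorem IsWeakGradient.locallyIntegrable_inner_self {u : 𝔼 → ℝ} {G : 𝔼 → 𝔼}
    (hG : IsWeakGradient u G) : LocallyIntegrable fun x => inner ℝ (G x) x := by
  simp only [PiLp.inner_apply, RCLike.inner_apply, conj_trivial, mul_comm (_ : ℝ) (G _ _)]
  exact locallyIntegrable_finsetSum _ fun i _ =>
    (hG.locallyIntegrable_apply i).mul_continuous (EuclideanSpace.proj (𝕜 := ℝ) i).continuous

theorem IsTestOn.isTestFunction {U : Set 𝔼} {φ : 𝔼 → ℝ} (hφ : IsTestOn ∞ U φ) :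
    IsTestFunction φ :=
  ⟨hφ.contDiff, hφ.hasCompactSupport⟩

theorem IsTestFunction.integrable_mul {h F : 𝔼 → ℝ} (hF : IsTestFunction F)
    (hh : LocallyIntegrable h) : Integrable fun x => h x * F x :=
  hh.integrable_smul_right_of_hasCompactSupport hF.1.continuous hF.2

theorem IsTestFunction.coord_mul {F : 𝔼 → ℝ} (hF : IsTestFunction F) (j : Fin n) :
    IsTestFunction fun x => x j * F x :=
  ⟨(EuclideanSpace.proj (𝕜 := ℝ) j).contDiff.mul hF.1, hF.2.mul_left⟩

theorem fderiv_coord_mul {F : 𝔼 → ℝ} {x : 𝔼} (hF : DifferentiableAt ℝ F x) (j : Fin n) (v : 𝔼) :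
    fderiv ℝ (fun y => y j * F y) x v = v j * F x + x j * fderiv ℝ F x v := by
  have hj : HasFDerivAt (fun y : 𝔼 => y j) (EuclideanSpace.proj (𝕜 := ℝ) j) x :=
    (EuclideanSpace.proj (𝕜 := ℝ) j).hasFDerivAt
  rw [(hj.fun_mul hF.hasFDerivAt).fderiv]
  simp
  ring

/-- The divergence of the vector field `x ↦ F x • x`. -/
def divSmulSelf (F : 𝔼 → ℝ) (x : 𝔼) : ℝ := n * F x + fderiv ℝ F x x

theorem IsTestFunction.divSmulSelf {F : 𝔼 → ℝ} (hF : IsTestFunction F) :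
    IsTestFunction (divSmulSelf F) :=
  ⟨(contDiff_const.mul hF.1).add ((hF.1.fderiv_right (m := ∞) (by simp)).clm_apply contDiff_id),
    hF.2.mul_left.add ((hF.2.fderiv ℝ).mono fun x hx h => hx (by simp [h]))⟩

theorem divSmulSelf_coord_mul {F : 𝔼 → ℝ} {x : 𝔼} (hF : DifferentiableAt ℝ F x) (j : Fin n) :
    divSmulSelf (fun y => y j * F y) x = x j * (F x + divSmulSelf F x) := by
  rw [divSmulSelf, divSmulSelf, fderiv_coord_mul hF]
  ring

theorem divSmulSelf_eq_sum {F : 𝔼 → ℝ} {x : 𝔼} (hF : DifferentiableAt ℝ F x) :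
    divSmulSelf F x =
      ∑ j, fderiv ℝ (fun y => y j * F y) x (EuclideanSpace.single j 1) := by
  have hx : x = ∑ j, x j • EuclideanSpace.single j (1 : ℝ) := by
    ext i
    simp [Pi.single_apply]
  have hself : fderiv ℝ F x x = ∑ j, x j * fderiv ℝ F x (EuclideanSpace.single j 1) := by
    conv_lhs => enter [2]; rw [hx]
    simp
  simp [divSmulSelf, fderiv_coord_mul hF, Finset.sum_add_distrib, hself]

theorem divSmulSelf_comp_norm {φ : ℝ → ℝ} {x : 𝔼} (hφ : DifferentiableAt ℝ φ ‖x‖) :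
    divSmulSelf (fun y => φ ‖y‖) x = n * φ ‖x‖ + ‖x‖ * deriv φ ‖x‖ := by
  rw [divSmulSelf, add_right_inj]
  rcases eq_or_ne x 0 with rfl | hx
  · simp
  · rw [(hasGradientAt_comp_norm hx hφ.hasDerivAt).hasFDerivAt.fderiv]
    have hx' : ‖x‖ ≠ 0 := norm_ne_zero_iff.mpr hx
    simp
    field_simp

theorem IsWeakGradient.integral_mul_divSmulSelf {u : 𝔼 → ℝ} {G : 𝔼 → 𝔼}
    (hG : IsWeakGradient u G) {F : 𝔼 → ℝ} (hF : IsTestFunction F) :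
    ∫ x, u x * divSmulSelf F x = -∫ x, inner ℝ (G x) x * F x := by
  calc ∫ x, u x * divSmulSelf F x
      = ∫ x, ∑ j, u x * fderiv ℝ (fun y => y j * F y) x (EuclideanSpace.single j 1) := by
        simp only [divSmulSelf_eq_sum (hF.1.differentiable (by simp) _), Finset.mul_sum]
    _ = ∑ j, ∫ x, u x * fderiv ℝ (fun y => y j * F y) x (EuclideanSpace.single j 1) :=
        integral_finsetSum _ fun j _ =>
          hG.locallyIntegrable.integrable_smul_right_of_hasCompactSupport
          (((hF.coord_mul j).1.continuous_fderiv (by simp)).clm_apply continuous_const)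
          ((hF.coord_mul j).2.fderiv_apply ℝ _)
    _ = ∑ j, -∫ x, G x j * (x j * F x) :=
        Finset.sum_congr rfl fun j _ => hG.weakPartial j _ (hF.coord_mul j)
    _ = -∫ x, inner ℝ (G x) x * F x := by
        rw [Finset.sum_neg_distrib, ← integral_finsetSum _ fun j _ =>
          (hF.coord_mul j).integrable_mul (hG.locallyIntegrable_apply j)]
        simp only [PiLp.inner_apply, RCLike.inner_apply, conj_trivial, Finset.sum_mul]
        congr! 4
        ring

theorem integral_inner_self_mul_divSmulSelf {G : 𝔼 → 𝔼} {K : Fin n → 𝔼 → 𝔼}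
    (hK : ∀ i, IsWeakGradient (fun x => G x i) (K i)) {F : 𝔼 → ℝ} (hF : IsTestFunction F) :
    ∫ x, inner ℝ (G x) x * (F x + divSmulSelf F x) =
      -∫ x, (∑ i, inner ℝ (K i x) x * x i) * F x := by
  have hd : Differentiable ℝ F := hF.1.differentiable (by simp)
  calc ∫ x, inner ℝ (G x) x * (F x + divSmulSelf F x)
      = ∫ x, ∑ i, G x i * divSmulSelf (fun y => y i * F y) x := by
        simp only [divSmulSelf_coord_mul (hd _), PiLp.inner_apply, RCLike.inner_apply,
          conj_trivial, Finset.sum_mul]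
        congr! 3
        ring
    _ = ∑ i, ∫ x, G x i * divSmulSelf (fun y => y i * F y) x :=
        integral_finsetSum _ fun i _ =>
          (hF.coord_mul i).divSmulSelf.integrable_mul (hK i).locallyIntegrable
    _ = ∑ i, -∫ x, inner ℝ (K i x) x * (x i * F x) :=
        Finset.sum_congr rfl fun i _ => (hK i).integral_mul_divSmulSelf (hF.coord_mul i)
    _ = -∫ x, (∑ i, inner ℝ (K i x) x * x i) * F x := by
        rw [Finset.sum_neg_distrib, ← integral_finsetSum _ fun i _ =>
          (hF.coord_mul i).integrable_mul (hK i).locallyIntegrable_inner_self]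
        simp only [Finset.sum_mul, mul_assoc]

theorem mul_add_mul_deriv_inv_pow_mul {φ : ℝ → ℝ} {r : ℝ} (hr : r ≠ 0)
    (hφ : DifferentiableAt ℝ φ r) (k : ℕ) :
    k * ((r ^ k)⁻¹ * φ r) + r * deriv (fun t => (t ^ k)⁻¹ * φ t) r =
      r * (r ^ k)⁻¹ * deriv φ r := by
  rw [(((hasDerivAt_pow k r).fun_inv (pow_ne_zero _ hr)).fun_mul hφ.hasDerivAt).deriv]
  cases k with
  | zero => simp
  | succ k =>
    simp only [Nat.add_sub_cancel]
    field_simp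
    ring

theorem IsWeakPartial.ae_eq_fderiv {i : Fin n} {u v w : 𝔼 → ℝ} {U : Set 𝔼}
    (huv : IsWeakPartial i u v) (hv : LocallyIntegrable v) (hU : IsOpen U)
    (hw : ContDiffOn ℝ 1 w U) (huw : ∀ᵐ x, u x = w x) :
    ∀ᵐ x, x ∈ U → v x = fderiv ℝ w x (EuclideanSpace.single i 1) := by
  have hwc : LocallyIntegrableOn w U := hw.continuousOn.locallyIntegrableOn hU.measurableSet
  have hw'c : LocallyIntegrableOn (fun x => fderiv ℝ w x (EuclideanSpace.single i 1)) U :=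
    ((hw.continuousOn_fderiv_of_isOpen hU le_rfl).clm_apply
      continuousOn_const).locallyIntegrableOn hU.measurableSet
  have hzero := hU.ae_eq_zero_of_integral_contDiff_smul_eq_zero
    ((hv.locallyIntegrableOn U).sub hw'c) fun ψ hψ hψc hψs => by
      have hψU : IsTestOn ∞ U ψ := ⟨hψ, hψc, hψs⟩
      have hparts : ∫ x, w x * fderiv ℝ ψ x (EuclideanSpace.single i 1) =
          -∫ x, fderiv ℝ w x (EuclideanSpace.single i 1) * ψ x :=
        integral_mul_fderiv_eq_neg_fderiv_mul_of_integrable (hψU.integrable_mul hw'c)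
          ((hψU.fderiv_apply _).integrable_mul hwc) (hψU.integrable_mul hwc)
          (fun x hx => (hw.differentiableOn (by simp)).differentiableAt (hU.mem_nhds (hψs hx)))
          fun x _ => hψ.differentiable (by simp) x
      have hweak : ∫ x, w x * fderiv ℝ ψ x (EuclideanSpace.single i 1) = -∫ x, v x * ψ x := by
        rw [← huv ψ hψU.isTestFunction]
        refine integral_congr_ae ?_
        filter_upwards [huw] with x hx
        rw [hx]
      simp only [Pi.sub_apply, smul_eq_mul, mul_comm (ψ _), sub_mul]
      rw [integral_sub (hψU.integrable_mul (hv.locallyIntegrableOn U)) (hψU.integrable_mul hw'c)]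
      linarith
  filter_upwards [hzero] with x hx hxU
  exact sub_eq_zero.mp (hx hxU)

variable [NeZero n]

theorem weakDeriv_sphereIntegral {V H : 𝔼 → ℝ} (hV : LocallyIntegrable V)
    (hH : LocallyIntegrable H) (m : ℕ)
    (hVH : ∀ F, IsTestFunction F → ∫ x, V x * (m * F x + divSmulSelf F x) = -∫ x, H x * F x)
    {φ : ℝ → ℝ} (hφ : IsTestOn ∞ (Ioi 0) φ) :
    ∫ r, sphereIntegral volume V r / r ^ m * deriv φ r =
      -∫ r, sphereIntegral volume H r / r ^ (m + 1) * φ r := by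
  have hpow : ContDiffOn ℝ ∞ (fun r : ℝ => (r ^ (n + m))⁻¹) (Ioi 0) :=
    (contDiff_id.pow (n + m)).contDiffOn.inv fun r hr => pow_ne_zero _ (ne_of_gt hr)
  have hχ : IsTestOn ∞ (Ioi 0) fun r => (r ^ (n + m))⁻¹ * φ r := hφ.contDiffOn_mul isOpen_Ioi hpow
  have hψ : IsTestOn ∞ (Ioi 0) fun r => r * (r ^ (n + m))⁻¹ * deriv φ r :=
    hφ.deriv.contDiffOn_mul isOpen_Ioi (contDiffOn_id.mul hpow)
  have hdiv : ∀ᵐ x : 𝔼, V x * (‖x‖ * (‖x‖ ^ (n + m))⁻¹ * deriv φ ‖x‖) =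
      V x * (m * ((‖x‖ ^ (n + m))⁻¹ * φ ‖x‖) +
        divSmulSelf (fun y => (‖y‖ ^ (n + m))⁻¹ * φ ‖y‖) x) := by
    filter_upwards [Measure.ae_ne volume (0 : 𝔼)] with x hx
    rw [divSmulSelf_comp_norm (φ := fun r => (r ^ (n + m))⁻¹ * φ r)
      (hχ.contDiff.differentiable (by simp) _), ← mul_add_mul_deriv_inv_pow_mul
      (norm_ne_zero_iff.mpr hx) (hφ.contDiff.differentiable (by simp) _)]
    push_cast
    ring
  have hradial := (integral_congr_ae hdiv).trans (hVH _ hχ.comp_norm.isTestFunction)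
  rw [integral_mul_comp_norm volume hV hψ.contDiff.continuous hψ.hasCompactSupport
      hψ.tsupport_subset, integral_mul_comp_norm volume hH hχ.contDiff.continuous
      hχ.hasCompactSupport hχ.tsupport_subset, finrank_euclideanSpace_fin] at hradial
  obtain ⟨N, rfl⟩ := Nat.exists_eq_add_one_of_ne_zero (NeZero.ne n)
  convert hradial using 1
  · refine integral_congr_ae ?_
    filter_upwards [Measure.ae_ne volume (0 : ℝ)] with r hr
    simp only [Nat.add_sub_cancel]
    field_simp
    ring
  · refine congrArg Neg.neg (integral_congr_ae ?_)
    filter_upwards [Measure.ae_ne volume (0 : ℝ)] with r hr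
    simp only [Nat.add_sub_cancel]
    field_simp
    ring

theorem locallyIntegrableOn_div_pow {S : ℝ → ℝ} (hS : LocallyIntegrableOn S (Ioi 0)) (m : ℕ) :
    LocallyIntegrableOn (fun r => S r / r ^ m) (Ioi 0) := by
  simp only [div_eq_mul_inv]
  exact hS.mul_continuousOn ((continuous_pow m).continuousOn.inv₀ fun r hr =>
    pow_ne_zero m (ne_of_gt hr)) isOpen_Ioi.isLocallyClosed

theorem exists_radial_profile {u : 𝔼 → ℝ} (hu : MemSobolevLoc 2 u) (hrad : IsRadial u) :
    ∃ g p : ℝ → ℝ, (∀ r ∈ Ioi (0 : ℝ), HasDerivAt g (p r) r) ∧ ContinuousOn p (Ioi 0) ∧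
      ∀ᵐ x, u x = g ‖x‖ := by
  obtain ⟨G, hG, hG1⟩ := hu.exists_isWeakGradient
  choose K hK _ using fun i => (hG1 i).exists_isWeakGradient
  have hV := hG.locallyIntegrable_inner_self
  have hH : LocallyIntegrable fun x => ∑ i, inner ℝ (K i x) x * x i :=
    locallyIntegrable_finsetSum _ fun i _ => (hK i).locallyIntegrable_inner_self.mul_continuous
      (EuclideanSpace.proj (𝕜 := ℝ) i).continuous
  have hSH := locallyIntegrableOn_div_pow (locallyIntegrableOn_sphereIntegral volume hH) 2
  obtain ⟨c, hc⟩ := ae_eq_primitive_of_weakDeriv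
    (locallyIntegrableOn_div_pow (locallyIntegrableOn_sphereIntegral volume hV) 1) hSH fun φ hφ =>
      weakDeriv_sphereIntegral hV hH 1 (fun F hF => by
        simpa using integral_inner_self_mul_divSmulSelf hK hF) hφ
  set P : ℝ → ℝ := fun r => c + ∫ t in (1 : ℝ)..r,
    sphereIntegral volume (fun x => ∑ i, inner ℝ (K i x) x * x i) t / t ^ 2
  have hP : ContinuousOn P (Ioi 0) := continuousOn_const.add (continuousOn_primitive hSH)
  obtain ⟨d, hd⟩ := ae_eq_primitive_of_weakDeriv
    (locallyIntegrableOn_sphereIntegral volume hG.locallyIntegrable)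
    (hP.locallyIntegrableOn measurableSet_Ioi) fun φ hφ => by
      have hweak := weakDeriv_sphereIntegral hG.locallyIntegrable hV 0 (fun F hF => by
        simpa using hG.integral_mul_divSmulSelf hF) hφ
      simp only [pow_zero, div_one, zero_add] at hweak
      refine hweak.trans (congrArg Neg.neg (integral_congr_ae ?_))
      filter_upwards [hc] with r hr
      by_cases hr' : r ∈ tsupport φ
      · rw [hr (hφ.tsupport_subset hr')]
      · rw [image_eq_zero_of_notMem_tsupport hr', mul_zero, mul_zero]
  obtain ⟨g₀, hg₀⟩ := hrad
  refine ⟨_, _, fun r hr => (hasDerivAt_primitive hP d hr).const_mul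
    ((volume : Measure 𝔼).toSphere.real univ)⁻¹, continuousOn_const.mul hP, ?_⟩
  filter_upwards [ae_eq_sphereIntegral_of_radial volume hg₀, ae_norm_of_ae volume hd]
    with x hx hx'
  rw [hx, hx']

theorem IsWeakGradient.ae_eq_of_radial_profile {u : 𝔼 → ℝ} {G : 𝔼 → 𝔼} (hG : IsWeakGradient u G)
    {g p : ℝ → ℝ} (hg : ∀ r ∈ Ioi (0 : ℝ), HasDerivAt g (p r) r) (hp : ContinuousOn p (Ioi 0))
    (hu : ∀ᵐ x, u x = g ‖x‖) : ∀ᵐ x, G x = (p ‖x‖ * ‖x‖⁻¹) • x := by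
  have hw : ContDiffOn ℝ 1 (fun x : 𝔼 => g ‖x‖) {0}ᶜ :=
    (contDiffOn_one_of_hasDerivAt isOpen_Ioi hg hp).comp
      (fun x hx => (contDiffAt_norm ℝ hx).contDiffWithinAt) fun x hx => norm_pos_iff.mpr hx
  filter_upwards [ae_all_iff.mpr fun i => (hG.weakPartial i).ae_eq_fderiv
    (hG.locallyIntegrable_apply i) isOpen_compl_singleton hw hu, Measure.ae_ne volume (0 : 𝔼)]
    with x hx hx0
  ext i
  rw [hx i hx0, (hasGradientAt_comp_norm hx0 (hg _ (norm_pos_iff.mpr hx0))).hasFDerivAt.fderiv]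
  simp [EuclideanSpace.inner_single_right]

end Sobolev

/-! ### Reduction to the radial equation -/

theorem one_add_sq_rpow_three_halves (t : ℝ) : (1 + t ^ 2) ^ (3 / 2 : ℝ) = √(1 + t ^ 2) ^ 3 := by
  rw [Real.sqrt_eq_rpow, ← Real.rpow_mul_natCast (by positivity)]
  norm_num

theorem jacobiWeight_eq_div_rpow (t : ℝ) :
    jacobiWeight t = t ^ 2 / (1 + t ^ 2) ^ (3 / 2 : ℝ) := by
  rw [jacobiWeight, one_add_sq_rpow_three_halves]

theorem jacobiWeight_abs (t : ℝ) : jacobiWeight |t| = jacobiWeight t := by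
  rw [jacobiWeight, jacobiWeight, sq_abs]

theorem jacobiWeight_nonneg (t : ℝ) : 0 ≤ jacobiWeight t := by
  unfold jacobiWeight
  positivity

theorem jacobiWeight_pos {t : ℝ} (ht : t ≠ 0) : 0 < jacobiWeight t :=
  div_pos (by positivity) (pow_pos (sqrt_one_add_sq_pos t) 3)

theorem jacobiWeight_le_sq (t : ℝ) : jacobiWeight t ≤ t ^ 2 :=
  div_le_self (sq_nonneg t) (one_le_pow₀ (one_le_sqrt_one_add_sq t))

theorem jacobiWeight_le_one (t : ℝ) : jacobiWeight t ≤ 1 := by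
  rw [jacobiWeight, div_le_one (pow_pos (sqrt_one_add_sq_pos t) 3)]
  calc t ^ 2 ≤ √(1 + t ^ 2) ^ 2 := by rw [sq_sqrt_one_add_sq]; linarith
    _ ≤ √(1 + t ^ 2) ^ 3 := pow_le_pow_right₀ (one_le_sqrt_one_add_sq t) (by norm_num)

theorem jacobiWeight_le_inv {t : ℝ} (ht : 0 < t) : jacobiWeight t ≤ t⁻¹ := by
  have hle : t ≤ √(1 + t ^ 2) := Real.le_sqrt_of_sq_le (by linarith)
  calc t ^ 2 / √(1 + t ^ 2) ^ 3 ≤ t ^ 2 / t ^ 3 := by gcongr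
    _ = t⁻¹ := by field_simp

theorem IsRadialSolution.exists_growth {N : ℕ} {f g p : ℝ → ℝ} (h : IsRadialSolution N f g p)
    (hN : 1 ≤ N) (hf : ContDiff ℝ 1 f)
    (hst : ∀ q, IsTestOn ∞ (Ioi 0) q → ∫ r, r ^ N * deriv f (g r) * q r ^ 2 ≤
      ∫ r, r ^ N * (1 / √(1 + p r ^ 2) ^ 3) * deriv q r ^ 2)
    (hp : ∃ r ∈ Ioi (0 : ℝ), p r ≠ 0) :
    ∃ c : ℝ, 0 < c ∧ ∃ R₀ : ℝ, 2 < R₀ ∧ ∀ R, R₀ ≤ R →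
      c * R ^ (2 * √N + 2) ≤ ∫ r in Icc R (2 * R), r ^ N * jacobiWeight (p r) := by
  obtain ⟨r₁, hr₁, hpr₁⟩ := hp
  refine exists_growth_of_hardy (Real.one_le_sqrt.mpr (by exact_mod_cast hN))
    (continuousOn_pow_mul N (continuous_jacobiWeight.comp_continuousOn h.continuousOn))
    (fun r hr => mul_nonneg (pow_nonneg (le_of_lt hr) N) (jacobiWeight_nonneg _)) (fun r hr => ?_)
    (fun η hη => ?_) hr₁ (mul_pos (pow_pos hr₁ N) (jacobiWeight_pos hpr₁))
  · calc r ^ N * jacobiWeight (p r) ≤ r ^ N * 1 :=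
          mul_le_mul_of_nonneg_left (jacobiWeight_le_one _) (pow_nonneg hr.1.le N)
      _ ≤ r := by
          rw [mul_one]
          exact pow_le_of_le_one hr.1.le hr.2 (by omega)
  · rw [Real.sq_sqrt (Nat.cast_nonneg N)]
    exact h.hardy_of_stable hf hst hη

section RadialReduction

variable {n : ℕ}

local notation "𝔼" => EuclideanSpace ℝ (Fin n)

variable {f g p : ℝ → ℝ} {u : EuclideanSpace ℝ (Fin n) → ℝ}
  {G : EuclideanSpace ℝ (Fin n) → EuclideanSpace ℝ (Fin n)} [NeZero n]

theorem integral_comp_norm_euclidean {F : ℝ → ℝ} (hF : ∀ r ∉ Ioi 0, F r = 0) :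
    ∫ x : 𝔼, F ‖x‖ =
      (volume : Measure 𝔼).toSphere.real univ * ∫ r, r ^ (n - 1) * F r := by
  simpa only [finrank_euclideanSpace_fin] using integral_comp_norm (volume : Measure 𝔼) hF

theorem IsWeakSolution.radial_equation (hsol : IsWeakSolution f u G)
    (hu : ∀ᵐ x, u x = g ‖x‖) (hG : ∀ᵐ x, G x = (p ‖x‖ * ‖x‖⁻¹) • x) {φ : ℝ → ℝ}
    (hφ : IsTestOn ∞ (Ioi 0) φ) :
    ∫ r, r ^ (n - 1) * mcFlux (p r) * deriv φ r = ∫ r, r ^ (n - 1) * f (g r) * φ r := by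
  have hflux : ∀ᵐ x, inner ℝ (G x) (gradient (fun y : 𝔼 => φ ‖y‖) x) / √(1 + ‖G x‖ ^ 2) =
      mcFlux (p ‖x‖) * deriv φ ‖x‖ := by
    filter_upwards [hG, Measure.ae_ne volume (0 : 𝔼)] with x hx hx0
    rw [(hasGradientAt_comp_norm hx0
        (hφ.contDiff.differentiable (by simp) _).hasDerivAt).gradient, hx, norm_radial_smul hx0,
      inner_radial_smul hx0, sq_abs, mcFlux]
    ring
  have hsource : ∀ᵐ x, f (u x) * φ ‖x‖ = f (g ‖x‖) * φ ‖x‖ := hu.mono fun x hx => by rw [hx]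
  have heq := hsol.equation _ hφ.comp_norm.isTestFunction
  rw [integral_congr_ae hflux, integral_congr_ae hsource,
    integral_comp_norm_euclidean (F := fun r => mcFlux (p r) * deriv φ r) fun r hr => by
      rw [image_eq_zero_of_notMem_tsupport fun h => hr (hφ.deriv.tsupport_subset h), mul_zero],
    integral_comp_norm_euclidean (F := fun r => f (g r) * φ r) fun r hr => by
      rw [image_eq_zero_of_notMem_tsupport fun h => hr (hφ.tsupport_subset h), mul_zero]] at heq
  simpa only [mul_assoc] using mul_left_cancel₀ (toSphere_real_univ_pos volume).ne' heq

theorem IsStableSolution.radial_stable (hst : IsStableSolution f u G)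
    (hu : ∀ᵐ x, u x = g ‖x‖) (hG : ∀ᵐ x, G x = (p ‖x‖ * ‖x‖⁻¹) • x) {q : ℝ → ℝ}
    (hq : IsTestOn ∞ (Ioi 0) q) :
    ∫ r, r ^ (n - 1) * deriv f (g r) * q r ^ 2 ≤
      ∫ r, r ^ (n - 1) * (1 / √(1 + p r ^ 2) ^ 3) * deriv q r ^ 2 := by
  have henergy : ∀ᵐ x, ‖gradient (fun y : 𝔼 => q ‖y‖) x‖ ^ 2 / √(1 + ‖G x‖ ^ 2) -
      inner ℝ (G x) (gradient (fun y : 𝔼 => q ‖y‖) x) ^ 2 / (1 + ‖G x‖ ^ 2) ^ (3 / 2 : ℝ) =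
      1 / √(1 + p ‖x‖ ^ 2) ^ 3 * deriv q ‖x‖ ^ 2 := by
    filter_upwards [hG, Measure.ae_ne volume (0 : 𝔼)] with x hx hx0
    rw [(hasGradientAt_comp_norm hx0
        (hq.contDiff.differentiable (by simp) _).hasDerivAt).gradient, hx, norm_radial_smul hx0,
      norm_radial_smul hx0, inner_radial_smul hx0, sq_abs, sq_abs,
      one_add_sq_rpow_three_halves]
    field_simp
    rw [sq_sqrt_one_add_sq]
    ring
  have hpotential : ∀ᵐ x, deriv f (u x) * q ‖x‖ ^ 2 = deriv f (g ‖x‖) * q ‖x‖ ^ 2 :=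
    hu.mono fun x hx => by rw [hx]
  have hle := hst.stable _ hq.comp_norm.isTestFunction
  rw [integral_congr_ae henergy, integral_congr_ae hpotential,
    integral_comp_norm_euclidean (F := fun r => deriv f (g r) * q r ^ 2) fun r hr => by
      rw [image_eq_zero_of_notMem_tsupport fun h => hr (hq.tsupport_subset h),
        zero_pow two_ne_zero, mul_zero],
    integral_comp_norm_euclidean (F := fun r => 1 / √(1 + p r ^ 2) ^ 3 * deriv q r ^ 2)
      fun r hr => by
        rw [image_eq_zero_of_notMem_tsupport fun h => hr (hq.deriv.tsupport_subset h),
          zero_pow two_ne_zero, mul_zero]] at hle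
  simpa only [mul_assoc] using le_of_mul_le_mul_left hle (toSphere_real_univ_pos volume)

theorem exists_deriv_ne_zero_of_not_isConstant (hg : ∀ r ∈ Ioi (0 : ℝ), HasDerivAt g (p r) r)
    (hu : ∀ᵐ x, u x = g ‖x‖) (hconst : ¬ IsConstant u) : ∃ r ∈ Ioi (0 : ℝ), p r ≠ 0 := by
  by_contra! hp
  have hg1 : ∀ r ∈ Ioi (0 : ℝ), g r = g 1 := fun r hr =>
    isOpen_Ioi.is_const_of_deriv_eq_zero isPreconnected_Ioi
      (fun x hx => (hg x hx).differentiableAt.differentiableWithinAt)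
      (fun x hx => by rw [(hg x hx).deriv, hp x hx, Pi.zero_apply]) hr (mem_Ioi.mpr one_pos)
  refine hconst ⟨g 1, ?_⟩
  filter_upwards [hu, Measure.ae_ne volume (0 : 𝔼)] with x hx hx0
  rw [hx, hg1 _ (norm_pos_iff.mpr hx0)]

theorem IsStableSolution.exists_profile (hst : IsStableSolution f u G) (hf : Continuous f)
    (hu : MemSobolevLoc 2 u) (hrad : IsRadial u) :
    ∃ g p : ℝ → ℝ, IsRadialSolution (n - 1) f g p ∧ (∀ᵐ x, u x = g ‖x‖) ∧
      ∀ᵐ x, G x = (p ‖x‖ * ‖x‖⁻¹) • x := by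
  obtain ⟨g, p, hg, hp, hug⟩ := exists_radial_profile hu hrad
  have hGp := hst.weakSolution.weakGradient.ae_eq_of_radial_profile hg hp hug
  exact ⟨g, p, .of_weak hp hg hf fun φ hφ => hst.weakSolution.radial_equation hug hGp hφ,
    hug, hGp⟩

theorem setAverage_annulus_jacobiWeight (hG : ∀ᵐ x, G x = (p ‖x‖ * ‖x‖⁻¹) • x) {R : ℝ}
    (hR : 0 < R) :
    ⨍ x in Metric.ball (0 : 𝔼) (2 * R) \ Metric.ball 0 R, jacobiWeight ‖G x‖ =
      n / (2 ^ n - 1) / R ^ n *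
        ∫ r in Icc R (2 * R), r ^ (n - 1) * jacobiWeight (p r) := by
  have hweight : ∀ᵐ x, jacobiWeight ‖G x‖ = jacobiWeight (p ‖x‖) := by
    filter_upwards [hG, Measure.ae_ne volume (0 : 𝔼)] with x hx hx0
    rw [hx, norm_radial_smul hx0, jacobiWeight_abs]
  rw [average_congr (ae_restrict_of_ae hweight),
    setAverage_annulus_comp_norm volume hR fun r => jacobiWeight (p r),
    finrank_euclideanSpace_fin]

theorem IsStableSolution.exists_average_lower_bound (hn : 2 ≤ n) (hf : ContDiff ℝ 1 f)
    (hst : IsStableSolution f u G) (hu : MemSobolevLoc 2 u) (hrad : IsRadial u)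
    (hconst : ¬ IsConstant u) :
    ∃ c : ℝ, 0 < c ∧ ∃ R₀ : ℝ, 2 < R₀ ∧ ∀ R : ℝ, R₀ ≤ R →
      c * R ^ (-(n : ℝ) + 2 * √((n : ℝ) - 1) + 2) ≤
        ⨍ x in Metric.ball (0 : 𝔼) (2 * R) \ Metric.ball 0 R, jacobiWeight ‖G x‖ := by
  obtain ⟨g, p, hgp, hug, hGp⟩ := hst.exists_profile hf.continuous hu hrad
  obtain ⟨c, hc, R₀, hR₀, hgrow⟩ := hgp.exists_growth (by omega) hf
    (fun q hq => hst.radial_stable hug hGp hq)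
    (exists_deriv_ne_zero_of_not_isConstant hgp.hasDerivAt hug hconst)
  have hκ : 0 < (n : ℝ) / (2 ^ n - 1) :=
    div_pos (by exact_mod_cast NeZero.pos n)
      (sub_pos.mpr (one_lt_pow₀ one_lt_two (NeZero.ne n)))
  refine ⟨n / (2 ^ n - 1) * c, mul_pos hκ hc, R₀, hR₀, fun R hR => ?_⟩
  have hR0 : 0 < R := by linarith
  calc n / (2 ^ n - 1) * c * R ^ (-(n : ℝ) + 2 * √((n : ℝ) - 1) + 2)
      = n / (2 ^ n - 1) / R ^ n * (c * R ^ (2 * √(n - 1 : ℕ) + 2)) := by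
        rw [Nat.cast_pred (NeZero.pos n),
          show -(n : ℝ) + 2 * √((n : ℝ) - 1) + 2 = 2 * √((n : ℝ) - 1) + 2 - n by ring,
          Real.rpow_sub hR0, Real.rpow_natCast]
        ring
    _ ≤ n / (2 ^ n - 1) / R ^ n *
          ∫ r in Icc R (2 * R), r ^ (n - 1) * jacobiWeight (p r) := by
        gcongr
        exact hgrow R hR
    _ = _ := (setAverage_annulus_jacobiWeight hGp hR0).symm

end RadialReduction

/-! ### Averages over dyadic annuli -/

/-- `h(x) = o(|x|^e)` as `|x| → ∞`, for a nonnegative function `h` defined almost everywhere: the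
absolute value of `h` is not taken. -/
def IsLittleORpow {n : ℕ} (h : EuclideanSpace ℝ (Fin n) → ℝ) (e : ℝ) : Prop :=
  ∀ ε : ℝ, 0 < ε → ∃ M : ℝ, ∀ᵐ x, M < ‖x‖ → h x ≤ ε * ‖x‖ ^ e

theorem rpow_le_two_rpow_abs_mul_rpow {R x : ℝ} (hR : 0 < R) (hRx : R ≤ x) (hx : x ≤ 2 * R)
    (e : ℝ) : x ^ e ≤ 2 ^ |e| * R ^ e := by
  rcases le_total 0 e with he | he
  · rw [abs_of_nonneg he, ← Real.mul_rpow zero_le_two hR.le]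
    exact Real.rpow_le_rpow (hR.le.trans hRx) hx he
  · calc x ^ e ≤ R ^ e := Real.rpow_le_rpow_of_nonpos hR hRx he
      _ ≤ 2 ^ |e| * R ^ e := le_mul_of_one_le_left (Real.rpow_nonneg hR.le e)
          (Real.one_le_rpow one_le_two (abs_nonneg e))

theorem setAverage_le_of_ae_le {α : Type*} [MeasurableSpace α] {μ : Measure α} {A : Set α}
    (hA : MeasurableSet A) (hfin : μ A ≠ ⊤) {h : α → ℝ} {M : ℝ} (hM : 0 ≤ M) (h0 : ∀ x, 0 ≤ h x)
    (hle : ∀ᵐ x ∂μ, x ∈ A → h x ≤ M) : ⨍ x in A, h x ∂μ ≤ M := by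
  have hint : ∫ x in A, h x ∂μ ≤ μ.real A * M := by
    rw [← smul_eq_mul, ← setIntegral_const]
    exact integral_mono_of_nonneg (.of_forall h0) (integrableOn_const hfin)
      ((ae_restrict_iff' hA).mpr hle)
  rw [setAverage_eq, smul_eq_mul]
  exact inv_mul_le_of_le_mul₀ measureReal_nonneg hM hint

section Decay

variable {n : ℕ} {h : EuclideanSpace ℝ (Fin n) → ℝ}
  {G : EuclideanSpace ℝ (Fin n) → EuclideanSpace ℝ (Fin n)}

theorem IsLittleORpow.exists_setAverage_lt {e : ℝ} (he : IsLittleORpow h e) (h0 : ∀ x, 0 ≤ h x)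
    {c : ℝ} (hc : 0 < c) (R₀ : ℝ) :
    ∃ R, R₀ ≤ R ∧ ⨍ x in Metric.ball 0 (2 * R) \ Metric.ball 0 R, h x < c * R ^ e := by
  obtain ⟨M, hM⟩ := he (c / 2 / 2 ^ |e|) (by positivity)
  obtain ⟨R, hRR₀, hRM, hR⟩ : ∃ R, R₀ ≤ R ∧ M < R ∧ 0 < R :=
    ((eventually_ge_atTop R₀).and ((eventually_gt_atTop M).and (eventually_gt_atTop 0))).exists
  refine ⟨R, hRR₀, lt_of_le_of_lt (b := c / 2 * R ^ e) ?_ (by gcongr; linarith)⟩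
  refine setAverage_le_of_ae_le (measurableSet_ball.diff measurableSet_ball)
    (measure_ne_top_of_subset sdiff_subset measure_ball_lt_top.ne) (by positivity) h0 ?_
  filter_upwards [hM] with x hx ⟨hx2R, hxR⟩
  rw [mem_ball_zero_iff] at hx2R
  rw [mem_ball_zero_iff, not_lt] at hxR
  calc h x ≤ c / 2 / 2 ^ |e| * ‖x‖ ^ e := hx (hRM.trans_le hxR)
    _ ≤ c / 2 / 2 ^ |e| * (2 ^ |e| * R ^ e) := by
        gcongr
        exact rpow_le_two_rpow_abs_mul_rpow hR hxR hx2R.le e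
    _ = c / 2 * R ^ e := by field_simp

theorem isLittleORpow_of_le_one {e : ℝ} (h1 : ∀ x, h x ≤ 1) (he : 0 < e) : IsLittleORpow h e := by
  intro ε hε
  obtain ⟨M, hM⟩ :=
    (((tendsto_rpow_atTop he).const_mul_atTop hε).eventually_ge_atTop 1).exists_forall_of_atTop
  exact ⟨M, .of_forall fun x hx => (h1 x).trans (hM _ hx.le)⟩

theorem NormIsLittleO.isLittleORpow_jacobiWeight {q : ℝ} (hG : NormIsLittleO G q) :
    IsLittleORpow (fun x => jacobiWeight ‖G x‖) (2 * q) := by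
  intro ε hε
  obtain ⟨M, hM⟩ := hG √ε (Real.sqrt_pos.mpr hε)
  refine ⟨M, hM.mono fun x hx hxM => ?_⟩
  calc jacobiWeight ‖G x‖ ≤ ‖G x‖ ^ 2 := jacobiWeight_le_sq _
    _ ≤ (√ε * ‖x‖ ^ q) ^ 2 := pow_le_pow_left₀ (norm_nonneg _) (hx hxM) 2
    _ = ε * ‖x‖ ^ (2 * q) := by
        rw [mul_pow, Real.sq_sqrt hε.le, ← Real.rpow_mul_natCast (norm_nonneg x), Nat.cast_two,
          mul_comm q]

theorem InvNormIsLittleO.isLittleORpow_jacobiWeight {q : ℝ} (hG : InvNormIsLittleO G q) :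
    IsLittleORpow (fun x => jacobiWeight ‖G x‖) q := by
  intro ε hε
  obtain ⟨M, hM⟩ := hG ε hε
  exact ⟨M, hM.mono fun x hx hxM =>
    (jacobiWeight_le_inv (norm_pos_iff.mpr (hx hxM).1)).trans (hx hxM).2⟩

end Decay

theorem growth_exponent_pos {t : ℝ} (h2 : 2 ≤ t) (h6 : t ≤ 6) : 0 < -t + 2 * √(t - 1) + 2 := by
  have hsqrt : (t - 2) / 2 < √(t - 1) := (Real.lt_sqrt (by linarith)).mpr (by nlinarith)
  linarith

theorem MemSobolevLoc.of_succ {n k : ℕ} {u : EuclideanSpace ℝ (Fin n) → ℝ}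
    (hu : MemSobolevLoc (k + 1) u) : MemSobolevLoc k u := by
  induction k generalizing u with
  | zero => exact hu.1
  | succ k ih => exact ⟨hu.1, fun i => (hu.2 i).imp fun _ hv => ⟨hv.1, ih hv.2⟩⟩

end StableMeanCurvature

end

theorem theorem1p7_general (n : ℕ) (hn : 2 ≤ n) (f : ℝ → ℝ) (hf : ContDiff ℝ 1 f)
    (u : EuclideanSpace ℝ (Fin n) → ℝ)
    (G : EuclideanSpace ℝ (Fin n) → EuclideanSpace ℝ (Fin n))
    (hu : StableMeanCurvature.MemSobolevLoc 2 u)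
    (hrad : StableMeanCurvature.IsRadial u)
    (hstable : StableMeanCurvature.IsStableSolution f u G) :
    (¬ StableMeanCurvature.IsConstant u →
      ∃ c : ℝ, 0 < c ∧ ∃ R₀ : ℝ, 2 < R₀ ∧ ∀ R : ℝ, R₀ ≤ R →
        c * R ^ (-(n : ℝ) + 2 * √((n : ℝ) - 1) + 2) ≤
          ⨍ x in Metric.ball (0 : EuclideanSpace ℝ (Fin n)) (2 * R) \ Metric.ball 0 R,
            ‖G x‖ ^ 2 / (1 + ‖G x‖ ^ 2) ^ (3 / 2 : ℝ)) ∧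
    ((n ≤ 6 ∨
      StableMeanCurvature.NormIsLittleO G (-(n : ℝ) / 2 + √((n : ℝ) - 1) + 1) ∨
      StableMeanCurvature.InvNormIsLittleO G (-(n : ℝ) + 2 * √((n : ℝ) - 1) + 2)) →
      StableMeanCurvature.IsConstant u) := by
  have : NeZero n := ⟨by omega⟩
  simp only [← StableMeanCurvature.jacobiWeight_eq_div_rpow]
  have hlower := hstable.exists_average_lower_bound hn hf hu hrad
  refine ⟨hlower, fun hcases => ?_⟩
  by_contra hconst
  obtain ⟨c, hc, R₀, -, hR₀⟩ := hlower hconst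
  have hdecay : StableMeanCurvature.IsLittleORpow
      (fun x => StableMeanCurvature.jacobiWeight ‖G x‖) (-n + 2 * √((n : ℝ) - 1) + 2) := by
    rcases hcases with h6 | hG | hG
    · exact StableMeanCurvature.isLittleORpow_of_le_one
        (fun x => StableMeanCurvature.jacobiWeight_le_one _)
        (StableMeanCurvature.growth_exponent_pos (by exact_mod_cast hn) (by exact_mod_cast h6))
    · convert hG.isLittleORpow_jacobiWeight using 1
      ring
    · exact hG.isLittleORpow_jacobiWeight
  obtain ⟨R, hR, hlt⟩ := hdecay.exists_setAverage_lt
    (fun x => StableMeanCurvature.jacobiWeight_nonneg _) hc R₀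
  exact (hR₀ R hR).not_gt hlt

theorem theorem1p7 (n : ℕ) (hn : 2 ≤ n) (f : ℝ → ℝ) (hf : ContDiff ℝ 1 f)
    (u : EuclideanSpace ℝ (Fin n) → ℝ)
    (G : EuclideanSpace ℝ (Fin n) → EuclideanSpace ℝ (Fin n))
    (hu : StableMeanCurvature.MemSobolevLoc 3 u)
    (hG : StableMeanCurvature.IsWeakGradient u G)
    (hrad : StableMeanCurvature.IsRadial u)
    (hstable : StableMeanCurvature.IsStableSolution f u G) :
    (¬ StableMeanCurvature.IsConstant u →
      ∃ c : ℝ, 0 < c ∧ ∃ R₀ : ℝ, 2 < R₀ ∧ ∀ R : ℝ, R₀ ≤ R →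
        c * R ^ (-(n : ℝ) + 2 * √((n : ℝ) - 1) + 2) ≤
          ⨍ x in Metric.ball (0 : EuclideanSpace ℝ (Fin n)) (2 * R) \ Metric.ball 0 R,
            ‖G x‖ ^ 2 / (1 + ‖G x‖ ^ 2) ^ (3 / 2 : ℝ)) ∧
    ((n ≤ 6 ∨
      (7 ≤ n ∧ StableMeanCurvature.NormIsLittleO G (-(n : ℝ) / 2 + √((n : ℝ) - 1) + 1)) ∨
      (7 ≤ n ∧ StableMeanCurvature.InvNormIsLittleO G (-(n : ℝ) + 2 * √((n : ℝ) - 1) + 2))) →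
      StableMeanCurvature.IsConstant u) :=
  (theorem1p7_general n hn f hf u G hu.of_succ hrad hstable).imp_right fun h hcases =>
    h (hcases.imp_right (Or.imp And.right And.right))
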